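/- **Setting.** Let $\mathbb T$ be a finite limit theory, given as a small category $\mathcal C_{\mathbb T}$ with finite limits, and let $\mathcal B=\mathrm{Lex}[\mathcal C_{\mathbb T},\mathbf{Set}]$ be its locally finitely presentable category of set-valued models. Every $x\in\mathcal C_{\mathbb T}$ gives a finitely presentable model $K_x=\mathcal C_{\mathbb T}(x,-)$, and every $p:y\to x$ a dual map $K_p:K_x\to K_y$. A *geometry* $(\mathbb T,\mathcal V,J)$ consists of * a saturated class $\mathcal V$ of maps between finitely presentable objects of $\mathcal B$: it contains the isomorphisms between finitely presentable objects and is closed under composition, right cancellation ($f,\,gf\in\mathcal V\Rightarrow g\in\mathcal V$), pushouts along maps between finitely presentable objects, and finite colimits in the category of arrows of $\mathcal B$; * a Grothendieck topology $J$ on $\mathcal C_{\mathbb T}$ that is generated by its covering families $(p_i:x_i\to x)_i$ with all $K_{p_i}\in\mathcal V$. *Spectra of set-valued models.* For $B\in\mathcal B$, let $\mathcal V_B$ be the full subcategory of the coslice $B\downarrow\mathcal B$ on the maps $n:B\to C$ that are pushouts of maps in $\mathcal V$. Let $J_B$ be the topology on $\mathcal V_B^{op}$ generated by the families $(m_i:n\to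 n_i)_i$, $n:B\to C$, for which there are a map $b:K_x\to C$ and a $J$-cover $(p_i:x_i\to x)_i$ with all $K_{p_i}\in\mathcal V$ such that $m_i$ is the pushout of $K_{p_i}$ along $b$. Put $\mathrm{Spec}(B)=\mathrm{Sh}(\mathcal V_B^{op},J_B)$. For $f:B\to B'$ let $f_*:\mathcal V_B\to\mathcal V_{B'}$ be the functor of pushout along $f$. Precomposition with $f_*$ is the direct image functor $\mathrm{Spec}(f)_*:\mathrm{Spec}(B')\to\mathrm{Spec}(B)$. *Modelled topoi.* Let $\mathcal F\simeq\mathrm{Sh}(\mathcal C_{\mathcal F},J_{\mathcal F})$ be a topos with a small site of definition such that $\mathcal C_{\mathcal F}$ has finite limits, and let $F:\mathcal C_{\mathbb T}\to\mathcal F$ be a model of $\mathbb T$ in $\mathcal F$, i.e. a functor that preserves finite limits. For $c\in\mathcal C_{\mathcal F}$ let $F(c)\in\mathcal B$ be the model $x\mapsto F(x)(c)$; for $s:c_1\to c_2$ let $F(s):F(c_2)\to F(c_1)$ be the restriction map. The category $\mathcal V_F$ has as objects the pairs $(c,l)$ with $l:F(c)\to B_{c,l}$ in $\mathcal V_{F(c)}$;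 a morphism $(c,l)\to(c',l')$ is a pair $(s,h)$ of $s:c'\to c$ and $h:B_{c,l}\to B_{c',l'}$ with $h\,l=l'\,F(s)$. The topology $J_F$ on $\mathcal V_F^{op}$ is generated by the horizontal families, the images of the $J_{\mathcal F}$-covers under $\mathcal C_{\mathcal F}\to\mathcal V_F^{op}$, $c\mapsto(c,1_{F(c)})$, and the vertical families, the images of the $J_{F(c)}$-covers under the fibre inclusions $\mathcal V_{F(c)}^{op}\to\mathcal V_F^{op}$, $l\mapsto(c,l)$. Put $\mathrm{Spec}(F)=\mathrm{Sh}(\mathcal V_F^{op},J_F)$. *Continuous sections.* The topoi $\mathrm{Spec}(F(c))$, $c\in\mathcal C_{\mathcal F}$, form a fibered topos over $\mathcal C_{\mathcal F}$; for $s:c_1\to c_2$ write $f_{s*}=\mathrm{Spec}(F(s))_*:\mathrm{Spec}(F(c_1))\to\mathrm{Spec}(F(c_2))$. Its direct fibration is the fibration over $\mathcal C_{\mathcal F}^{op}$ with fibre $\mathrm{Spec}(F(c))$ over $c$ and with these direct image functors as transition functors. So a section $X$ of it consists of $X_c\in\mathrm{Spec}(F(c))$ for all $c$ and maps $X_s:X_{c_2}\to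 f_{s*}X_{c_1}$ for all $s:c_1\to c_2$, functorial in $s$. The section $X$ is *continuous* if for every $J_{\mathcal F}$-covering family $(s_i:c_i\to c)_{i\in I}$, with $c_{ij}=c_i\times_c c_j$ and $s_{ij}:c_{ij}\to c$ the canonical map, the maps $X_{s_i}$ exhibit $$X_c\longrightarrow\prod_{i\in I}f_{s_i*}X_{c_i}\rightrightarrows\prod_{i,j\in I}f_{s_{ij}*}X_{c_{ij}}$$ as an equalizer in $\mathrm{Spec}(F(c))$, where the two maps are induced by the values of $X$ at the two projections of the $c_{ij}$. Morphisms of continuous sections are the natural transformations with vertical components. **Theorem.** For every geometry $(\mathbb T,\mathcal V,J)$, every topos $\mathcal F$ with such a site of definition, and every model $F$ of $\mathbb T$ in $\mathcal F$: 1. for every $s:c_1\to c_2$ in $\mathcal C_{\mathcal F}$ the pushout functor $F(s)_*^{op}:(\mathcal V_{F(c_2)}^{op},J_{F(c_2)})\to(\mathcal V_{F(c_1)}^{op},J_{F(c_1)})$ preserves covers; 2. $\mathrm{Spec}(F)=\mathrm{Sh}(\mathcal V_F^{op},J_F)$ is equivalent to the category of continuous sections of the direct fibration of the fibered topos $c\mapsto\mathrm{Spec}(F(c))$.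 -/

import Mathlib

open CategoryTheory Limits Opposite

universe u v w

/- Without this line the types of morphisms in structures would be found through a reflexive quiver. -/
attribute [-instance] CategoryTheory.catToReflQuiver

section Models
attribute [local instance] Cardinal.fact_isRegular_aleph0

instance ind_isLocallyFinitelyPresentable (C : Type u) [SmallCategory C] [HasFiniteColimits C] :
    IsLocallyFinitelyPresentable.{u} (Ind C) where
  toHasColimitsOfSize := inferInstance
  toHasCardinalFilteredGenerator := by
    have hfp : ∀ x : C, IsFinitelyPresentable.{u} (Ind.yoneda.obj x) := by
      intro x
      have e : coyoneda.obj (op (Ind.yoneda.obj x)) ≅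
          Ind.inclusion C ⋙ (evaluation _ _).obj (op x) :=
        NatIso.ofComponents (fun Y =>
          (Ind.inclusion.fullyFaithful.homEquiv.trans
            (((Ind.yonedaCompInclusion.app x).symm.homCongr (Iso.refl _)).symm.trans
              yonedaEquiv)).toIso) (by
          intro Y Z f
          ext g
          simp [yonedaEquiv])
      rw [isFinitelyPresentable_iff_preservesFilteredColimits]
      constructor
      intro J _ _
      exact preservesColimitsOfShape_of_natIso e.symm
    refine ObjectProperty.IsCardinalFilteredGenerator.hasCardinalFilteredGenerator
      (P := ObjectProperty.ofObj (fun x : C => Ind.yoneda.obj x)) ⟨?_, ?_⟩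
    · rintro _ ⟨x⟩
      exact hfp x
    · intro X
      refine ⟨X.presentation.I, inferInstance, (isCardinalFiltered_aleph0_iff _).2 inferInstance, ?_⟩
      refine ⟨⟨⟨X.presentation.F ⋙ Ind.yoneda, ((colimit.cocone _).extend X.colimitPresentationCompYoneda.hom).ι, IsColimit.extendIso _ (colimit.isColimit _)⟩, ?_⟩⟩
      intro j
      exact ⟨_⟩

/-- A saturated class of maps between finitely presentable objects: it is closed under composition,
contains the isomorphisms between finitely presentable objects, is right cancellative, is closed
under pushout along maps between finitely presentable objects, and is closed under finite colimits
in the category of arrows. -/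
structure IsSaturatedClass {B : Type u} [Category.{v} B] (V : MorphismProperty B) : Prop where
  isFinitelyPresentable : ∀ ⦃X Y : B⦄ (f : X ⟶ Y), V f →
    IsFinitelyPresentable.{w} X ∧ IsFinitelyPresentable.{w} Y
  comp : ∀ ⦃X Y Z : B⦄ (f : X ⟶ Y) (g : Y ⟶ Z), V f → V g → V (f ≫ g)
  iso : ∀ ⦃X Y : B⦄ (f : X ⟶ Y) [IsIso f],
    IsFinitelyPresentable.{w} X → IsFinitelyPresentable.{w} Y → V f
  right_cancel : ∀ ⦃X Y Z : B⦄ (f : X ⟶ Y) (g : Y ⟶ Z), V f → V (f ≫ g) → V g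
  cobase_change : ∀ ⦃K K' P P' : B⦄ (l : K ⟶ K') (a : K ⟶ P) (l' : P ⟶ P') (a' : K' ⟶ P'),
    V l → IsFinitelyPresentable.{w} P → IsPushout a l l' a' → V l'
  finite_colimit : ∀ (I : Type) [SmallCategory I] [FinCategory I] (D : I ⥤ Arrow B) (c : Cocone D),
    Nonempty (IsColimit c) → (∀ i, V (D.obj i).hom) → V c.pt.hom

/-- The pushouts of the maps of a saturated class are closed under composition. -/
theorem IsSaturatedClass.pushouts_comp {B : Type u} [Category.{v} B]
    [IsLocallyFinitelyPresentable.{w} B] {V : MorphismProperty B} [HasPushouts B]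
    (hV : IsSaturatedClass.{u, v, w} V) :
    ∀ ⦃X Y Z : B⦄ (n : X ⟶ Y) (m : Y ⟶ Z), V.pushouts n → V.pushouts m → V.pushouts (n ≫ m) := by
  rintro X Y Z n m ⟨K, K', l, a, g, hl, sq⟩ ⟨L, L', k, b, d, hk, sq'⟩
  obtain ⟨P, _, hP⟩ := HasCardinalFilteredGenerator.exists_generator.{w} B Cardinal.aleph0
  obtain ⟨J, _, hJ, ⟨⟨⟨D, s, hs⟩, hD⟩⟩⟩ := hP.exists_colimitsOfShape X
  have hJ' : IsFiltered J := (isCardinalFiltered_aleph0_iff _).1 hJ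
  have hfp : ∀ j, IsFinitelyPresentable.{w} (D.obj j) := fun j => hP.le_isCardinalPresentable _ (hD j)
  have := (hV.isFinitelyPresentable _ hl).1
  have := (hV.isFinitelyPresentable _ hk).1
  obtain ⟨j₁, p, hp⟩ := IsFinitelyPresentable.exists_hom_of_isColimit hs a
  let t : ∀ j, D.obj j ⟶ X := fun j => s.app j
  have ht : ∀ {i j} (u : i ⟶ j), D.map u ≫ t j = t i := fun u =>
    (s.naturality u).trans (Category.comp_id _)
  replace hp : p ≫ t j₁ = a := hp
  subst hp
  let f' : D.obj j₁ ⟶ pushout l p := pushout.inr l p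
  have hf' : V f' := hV.cobase_change l p f' (pushout.inl l p) hl (hfp _)
    (IsPushout.of_hasPushout l p).flip
  obtain ⟨g', h⟩ : ∃ g', IsPushout (t j₁) f' n g' := by
    refine ⟨pushout.desc g (t j₁ ≫ n) (by simpa using sq.w.symm), ?_⟩
    refine IsPushout.of_left (h₁₁ := p) (v₁₁ := l) (h₂₁ := pushout.inl l p) ?_ ?_
      (IsPushout.of_hasPushout l p).flip
    · rwa [pushout.inl_desc]
    · rw [pushout.inr_desc]
  let D' : Under j₁ ⥤ B :=
    (Under.post D ⋙ Under.pushout f') ⋙ CategoryTheory.Under.forget _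
  let c' : Cocone D' :=
    (Under.pushout f' ⋙ CategoryTheory.Under.forget _).mapCocone
      ((Cocone.mk _ s).underPost j₁)
  let hc' : IsColimit c' :=
    isColimitOfPreserves _ (hs.underPost j₁)
  obtain ⟨j₃, q, hq⟩ := IsFinitelyPresentable.exists_hom_of_isColimit hc'
    (b ≫ h.isoPushout.hom : L ⟶ pushout (t j₁) f')
  change L ⟶ pushout (D.map j₃.hom) f' at q
  replace hq : (q ≫ pushout.desc (t j₃.right ≫ pushout.inl _ _) (pushout.inr _ _)
    (by rw [reassoc_of% ht, pushout.condition]) : L ⟶ pushout (t j₁) f') =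
      b ≫ h.isoPushout.hom := by
    rw [← hq]
    congr 1
  let f₃ : D.obj j₃.right ⟶ pushout (D.map j₃.hom) f' := pushout.inl _ _
  have hf₃ : V f₃ := hV.cobase_change f' _ f₃ (pushout.inr _ _) hf' (hfp _)
    (IsPushout.of_hasPushout _ _)
  let k₃ : pushout (D.map j₃.hom) f' ⟶ pushout k q := pushout.inr k q
  have hk₃ : V k₃ := hV.cobase_change k q k₃ (pushout.inl _ _) hk (hV.isFinitelyPresentable _ hf₃).2
    (IsPushout.of_hasPushout _ _).flip
  obtain ⟨e, he₁, he₂⟩ : ∃ e : pushout (D.map j₃.hom) f' ⟶ Y,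
      pushout.inl _ _ ≫ e = t j₃.right ≫ n ∧ pushout.inr _ _ ≫ e = g' :=
    ⟨pushout.desc (t j₃.right ≫ n) g' (by rw [reassoc_of% ht, h.w]), pushout.inl_desc _ _ _,
      pushout.inr_desc _ _ _⟩
  have sq₃ : IsPushout (t j₃.right) f₃ n e := by
    refine IsPushout.of_left (h₁₁ := D.map j₃.hom) (v₁₁ := f') (h₂₁ := pushout.inr _ _) ?_
      he₁.symm (IsPushout.of_hasPushout _ _)
    rwa [ht, he₂]
  have hb : q ≫ e = b := by
    rw [← cancel_mono h.isoPushout.hom, ← hq, Category.assoc]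
    congr 1
    apply pushout.hom_ext
    · rw [reassoc_of% he₁, pushout.inl_desc, h.inl_isoPushout_hom]
    · rw [reassoc_of% he₂, pushout.inr_desc, h.inr_isoPushout_hom]
  obtain ⟨e', he₁', he₂'⟩ : ∃ e' : pushout k q ⟶ Z,
      pushout.inl _ _ ≫ e' = d ∧ pushout.inr _ _ ≫ e' = e ≫ m :=
    ⟨pushout.desc d (e ≫ m) (by rw [reassoc_of% hb, sq'.w]), pushout.inl_desc _ _ _,
      pushout.inr_desc _ _ _⟩
  have sq₄ : IsPushout e k₃ m e' := by
    refine IsPushout.of_left (h₁₁ := q) (v₁₁ := k) (h₂₁ := pushout.inl _ _) ?_ he₂'.symm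
      (IsPushout.of_hasPushout _ _).flip
    rwa [hb, he₁']
  exact ⟨_, _, _, _, _, hV.comp _ _ hf₃ hk₃, sq₃.paste_vert sq₄⟩


theorem IsSaturatedClass.pushouts_id {B : Type u} [Category.{v} B]
    [IsLocallyFinitelyPresentable.{w} B] {V : MorphismProperty B}
    (hV : IsSaturatedClass.{u, v, w} V) (X : B) : V.pushouts (𝟙 X) := by
  obtain ⟨P, _, hP⟩ := HasCardinalFilteredGenerator.exists_generator.{w} B Cardinal.aleph0
  obtain ⟨J, _, hJ, ⟨⟨⟨D, s, hs⟩, hD⟩⟩⟩ := hP.exists_colimitsOfShape X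
  have hJ' : IsFiltered J := (isCardinalFiltered_aleph0_iff _).1 hJ
  obtain ⟨j⟩ := hJ'.nonempty
  have : IsFinitelyPresentable.{w} (D.obj j) := hP.le_isCardinalPresentable _ (hD j)
  let t : D.obj j ⟶ X := s.app j
  exact ⟨_, _, 𝟙 (D.obj j), t, t, hV.iso _ this this,
    IsPushout.of_vert_isIso ⟨by simp⟩⟩

/-- The category of set-valued models of the finite limit theory given by the lex category `T`:
the finite limit preserving functors `T ⥤ Type u`. -/
abbrev Models (T : Type u) [SmallCategory T] : Type (u + 1) := T ⥤ₗ Type u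

variable (T : Type u) [SmallCategory T]
/-- Double opposites do not change the category of models. -/
def modelsOpOpEquivalence : (Tᵒᵖᵒᵖ ⥤ₗ Type u) ≌ Models T where
  functor := ObjectProperty.lift _ (LeftExactFunctor.forget _ _ ⋙
    (Functor.whiskeringLeft _ _ _).obj (opOp T)) (fun F => by
      dsimp
      have : PreservesFiniteLimits (opOp T) := by
        have : (opOp T).IsEquivalence := (opOpEquivalence T).isEquivalence_inverse
        infer_instance
      exact comp_preservesFiniteLimits _ _)
  inverse := ObjectProperty.lift _ (LeftExactFunctor.forget _ _ ⋙
    (Functor.whiskeringLeft _ _ _).obj (unopUnop T)) (fun F => by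
      dsimp
      have : PreservesFiniteLimits (unopUnop T) := by
        have : (unopUnop T).IsEquivalence := (opOpEquivalence T).isEquivalence_functor
        infer_instance
      exact comp_preservesFiniteLimits _ _)
  unitIso := Iso.refl _
  counitIso := Iso.refl _

instance [HasFiniteLimits T] : IsLocallyFinitelyPresentable.{u} (Models T) :=
  ((Ind.leftExactFunctorEquivalence Tᵒᵖ).trans (modelsOpOpEquivalence T)).isCardinalLocallyPresentable _

instance [HasFiniteLimits T] : HasColimits (Models T) :=
  (inferInstance : IsLocallyFinitelyPresentable.{u} (Models T)).toHasColimitsOfSize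

/-- The functor `x ↦ T(x, -)`. It sends a map of `T` to its dual, a map between finitely
presentable models. -/
def corep : Tᵒᵖ ⥤ Models T :=
  ObjectProperty.lift _ coyoneda (fun x => by
    rw [leftExactFunctor_iff]; infer_instance)


variable {T} in
/-- A model `F` of the theory `T` in a topos `A` with site of presentation `(C, J)` is a finite limit
preserving functor `T ⥤ A`. It has a set-valued model `F(c) : x ↦ F(x)(c)` for each `c` in `C`
and a restriction map `F(s) : F(c') ⟶ F(c)` for each `s : c ⟶ c'`. -/
def evalModel {C : Type u} [SmallCategory C] {J : GrothendieckTopology C} {A : Type w}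
    [Category.{v} A] (e : A ≌ Sheaf J (Type u)) (F : T ⥤ₗ A) : Cᵒᵖ ⥤ Models T :=
  ObjectProperty.lift _ (F.obj ⋙ e.functor ⋙ sheafToPresheaf J (Type u)).flip fun c => by
    have h₁ : PreservesFiniteLimits F.obj := F.property
    have h₂ : PreservesFiniteLimits (sheafToPresheaf J (Type u)) := inferInstance
    have h₃ : PreservesFiniteLimits (F.obj ⋙ e.functor ⋙ sheafToPresheaf J (Type u) ⋙
      (evaluation Cᵒᵖ (Type u)).obj c) := inferInstance
    exact h₃

end Models

section EtaleUnder
variable {B : Type u} [Category.{v} B]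

/-- An object under `X` whose structure map lies in the class `E`. -/
structure EtaleUnder (E : MorphismProperty B) (X : B) where
  /-- the codomain -/
  right : B
  /-- the structure map -/
  hom : X ⟶ right
  prop : E hom

namespace EtaleUnder
variable {E : MorphismProperty B} {X Y Z : B}

/-- A morphism under `X`. -/
@[ext]
structure Hom (n m : EtaleUnder E X) where
  /-- the underlying map -/
  right : n.right ⟶ m.right
  w : n.hom ≫ right = m.hom

attribute [simp] Hom.w

/-- The full subcategory of the category of objects under `X` on the maps in `E`. -/
instance : Category (EtaleUnder E X) where
  Hom := Hom
  id n := ⟨𝟙 _, Category.comp_id _⟩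
  comp f g := ⟨f.right ≫ g.right, by rw [← Category.assoc, f.w, g.w]⟩

@[ext]
theorem hom_ext {n m : EtaleUnder E X} {f g : n ⟶ m} (h : f.right = g.right) : f = g :=
  Hom.ext h

@[simp] theorem id_right (n : EtaleUnder E X) : Hom.right (𝟙 n) = 𝟙 n.right := rfl

@[simp] theorem comp_right {n m k : EtaleUnder E X} (f : n ⟶ m) (g : m ⟶ k) :
    (f ≫ g).right = f.right ≫ g.right := rfl

@[simp] theorem w {n m : EtaleUnder E X} (f : n ⟶ m) : n.hom ≫ f.right = m.hom := f.2

@[simp] theorem w_assoc {n m : EtaleUnder E X} (f : n ⟶ m) {W : B} (t : m.right ⟶ W) :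
    n.hom ≫ f.right ≫ t = m.hom ≫ t := by
  rw [← Category.assoc, w]

/-- The functor taking the codomain. -/
@[simps]
def cod (E : MorphismProperty B) (X : B) : EtaleUnder E X ⥤ B where
  obj n := n.right
  map f := f.right

/-- A square of maps under `X` is a pushout if the underlying square is. -/
theorem isPushout_of_right {n n₁ n₂ q : EtaleUnder E X} {m : n ⟶ n₁} {h : n ⟶ n₂} {a : n₁ ⟶ q}
    {b : n₂ ⟶ q} (sq : IsPushout m.right h.right a.right b.right) : IsPushout m h a b where
  w := by ext; exact sq.w
  isColimit' := ⟨PushoutCocone.IsColimit.mk _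
    (fun s => ⟨sq.desc s.inl.right s.inr.right (congrArg Hom.right s.condition), by
      rw [← EtaleUnder.w a, Category.assoc, sq.inl_desc, EtaleUnder.w]⟩)
    (fun s => by ext; exact sq.inl_desc _ _ _)
    (fun s => by ext; exact sq.inr_desc _ _ _)
    (fun s t h₁ h₂ => by
      ext
      refine sq.hom_ext ?_ ?_
      · exact (congrArg Hom.right h₁).trans (sq.inl_desc _ _ _).symm
      · exact (congrArg Hom.right h₂).trans (sq.inr_desc _ _ _).symm)⟩

variable [HasPushouts B] [E.IsStableUnderCobaseChange]


theorem exists_isPushout [E.IsStableUnderComposition]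
    {n n₁ n₂ : EtaleUnder E X} (m : n ⟶ n₁) (h : n ⟶ n₂) (hm : E m.right) :
    ∃ (q : EtaleUnder E X) (a : n₁ ⟶ q) (b : n₂ ⟶ q),
      IsPushout m.right h.right a.right b.right := by
  refine ⟨⟨_, n₂.hom ≫ pushout.inr m.right h.right,
    E.comp_mem _ _ n₂.prop (E.pushout_inr _ _ hm)⟩,
    ⟨pushout.inl _ _, ?_⟩, ⟨pushout.inr _ _, rfl⟩, IsPushout.of_hasPushout _ _⟩
  change n₁.hom ≫ pushout.inl _ _ = n₂.hom ≫ pushout.inr _ _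
  rw [← m.w, ← h.w, Category.assoc, Category.assoc, pushout.condition]

theorem right_isPushout [E.IsStableUnderComposition]
    {n n₁ n₂ q : EtaleUnder E X} {m : n ⟶ n₁} {h : n ⟶ n₂} {a : n₁ ⟶ q} {b : n₂ ⟶ q}
    (hm : E m.right) (sq : IsPushout m h a b) :
    IsPushout m.right h.right a.right b.right := by
  obtain ⟨q', a', b', sq'⟩ := exists_isPushout m h hm
  have sq'' := isPushout_of_right sq'
  let e := sq''.isoIsPushout _ _ sq
  refine sq'.of_iso (Iso.refl _) (Iso.refl _) (Iso.refl _) ((cod E X).mapIso e) ?_ ?_ ?_ ?_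
  · simp
  · simp
  · exact (congrArg Hom.right (sq''.inl_isoIsPushout_hom _ _ sq)).trans (Category.id_comp _).symm
  · exact (congrArg Hom.right (sq''.inr_isoIsPushout_hom _ _ sq)).trans (Category.id_comp _).symm

/-- Pushing out along `f`, as a functor from objects under `X` to objects under `Y`. -/
noncomputable def cobaseChange (E : MorphismProperty B) [E.IsStableUnderCobaseChange] (f : X ⟶ Y) :
    EtaleUnder E X ⥤ EtaleUnder E Y where
  obj n := ⟨pushout n.hom f, pushout.inr n.hom f, E.pushout_inr _ _ n.prop⟩
  map {n n'} m := ⟨pushout.desc (m.right ≫ pushout.inl n'.hom f) (pushout.inr n'.hom f)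
    (by rw [← Category.assoc, m.w, pushout.condition]), pushout.inr_desc _ _ _⟩
  map_id n := by
    ext
    · exact (pushout.inl_desc _ _ _).trans ((Category.id_comp _).trans (Category.comp_id _).symm)
    · exact (pushout.inr_desc _ _ _).trans (Category.comp_id _).symm
  map_comp {n n' n''} m m' := by
    ext
    · refine (pushout.inl_desc _ _ _).trans (Eq.symm ?_)
      refine (pushout.inl_desc_assoc _ _ _ _).trans ?_
      refine (Category.assoc _ _ _).trans (Eq.trans ?_ (Category.assoc _ _ _).symm)
      exact congrArg (m.right ≫ ·) (pushout.inl_desc _ _ _)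
    · refine (pushout.inr_desc _ _ _).trans (Eq.symm ?_)
      exact (pushout.inr_desc_assoc _ _ _ _).trans (pushout.inr_desc _ _ _)

/-- The canonical map to the pushout of `n` along `f`. -/
noncomputable def toPushout (f : X ⟶ Y) (n : EtaleUnder E X) :
    n.right ⟶ ((cobaseChange E f).obj n).right :=
  pushout.inl n.hom f

theorem isPushout (f : X ⟶ Y) (n : EtaleUnder E X) :
    IsPushout n.hom f (toPushout f n) ((cobaseChange E f).obj n).hom :=
  IsPushout.of_hasPushout n.hom f

@[simp]
theorem toPushout_map (f : X ⟶ Y) {n n' : EtaleUnder E X} (m : n ⟶ n') :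
    toPushout f n ≫ ((cobaseChange E f).map m).right = m.right ≫ toPushout f n' :=
  pushout.inl_desc _ _ _

@[simp]
theorem toPushout_map_assoc (f : X ⟶ Y) {n n' : EtaleUnder E X} (m : n ⟶ n') {W : B}
    (t : ((cobaseChange E f).obj n').right ⟶ W) :
    toPushout f n ≫ ((cobaseChange E f).map m).right ≫ t = m.right ≫ toPushout f n' ≫ t := by
  rw [← Category.assoc, toPushout_map, Category.assoc]

@[ext 1100]
theorem cobaseChange_hom_ext {f : X ⟶ Y} {n : EtaleUnder E X} {k : EtaleUnder E Y}
    {a b : (cobaseChange E f).obj n ⟶ k}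
    (h : toPushout f n ≫ a.right = toPushout f n ≫ b.right) : a = b := by
  apply EtaleUnder.hom_ext
  exact (isPushout f n).hom_ext h (by rw [EtaleUnder.w, EtaleUnder.w])

/-- The map out of a pushout of `n` induced by a map out of `n`. -/
noncomputable def cobaseChangeDesc {f : X ⟶ Y} {n : EtaleUnder E X} {k : EtaleUnder E Y}
    (t : n.right ⟶ k.right) (ht : n.hom ≫ t = f ≫ k.hom) : (cobaseChange E f).obj n ⟶ k :=
  ⟨(isPushout f n).desc t k.hom ht, (isPushout f n).inr_desc _ _ _⟩

@[simp]
theorem toPushout_desc {f : X ⟶ Y} {n : EtaleUnder E X} {k : EtaleUnder E Y}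
    (t : n.right ⟶ k.right) (ht : n.hom ≫ t = f ≫ k.hom) :
    toPushout f n ≫ (cobaseChangeDesc t ht).right = t :=
  (isPushout f n).inl_desc _ _ _

@[simp]
theorem toPushout_desc_assoc {f : X ⟶ Y} {n : EtaleUnder E X} {k : EtaleUnder E Y}
    (t : n.right ⟶ k.right) (ht : n.hom ≫ t = f ≫ k.hom) {W : B} (r : k.right ⟶ W) :
    toPushout f n ≫ (cobaseChangeDesc t ht).right ≫ r = t ≫ r := by
  rw [← Category.assoc, toPushout_desc]

/-- Pushing out along an identity does nothing. -/
noncomputable def cobaseChangeId {f : X ⟶ X} (hf : f = 𝟙 X) : cobaseChange E f ≅ 𝟭 _ :=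
  NatIso.ofComponents (fun n =>
    { hom := cobaseChangeDesc (𝟙 n.right) (by simp [hf])
      inv := ⟨toPushout f n, by simp [(isPushout f n).w, hf]⟩
      hom_inv_id := by ext; simp
      inv_hom_id := by ext; simp })
    (fun m => by ext; simp)

/-- Pushing out along a composite amounts to pushing out twice. -/
noncomputable def cobaseChangeComp {f : X ⟶ Y} {g : Y ⟶ Z} {h : X ⟶ Z} (w : f ≫ g = h) :
    cobaseChange E f ⋙ cobaseChange E g ≅ cobaseChange E h :=
  NatIso.ofComponents (fun n =>
    { hom := cobaseChangeDesc ((isPushout f n).desc (toPushout h n) (g ≫ ((cobaseChange E h).obj n).hom)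
        (by rw [(isPushout h n).w, ← w, Category.assoc])) (by simp)
      inv := cobaseChangeDesc (toPushout f n ≫ toPushout g _) (by
        have h₁ := (isPushout f n).w
        have h₂ := (isPushout g ((cobaseChange E f).obj n)).w
        dsimp only [Functor.comp_obj]
        rw [← Category.assoc, h₁, Category.assoc, h₂, ← w, Category.assoc])
      hom_inv_id := by
        refine cobaseChange_hom_ext ((isPushout f n).hom_ext ?_ ?_)
        · simp
        · simp [(isPushout g ((cobaseChange E f).obj n)).w]
      inv_hom_id := by ext; simp })
    (fun {n n'} m => by
      refine cobaseChange_hom_ext ((isPushout f n).hom_ext ?_ ?_) <;> simp)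

theorem toPushout_cobaseChangeId_hom {f : X ⟶ X} (hf : f = 𝟙 X) (n : EtaleUnder E X) :
    toPushout f n ≫ ((cobaseChangeId hf).hom.app n).right = 𝟙 n.right :=
  toPushout_desc _ _

theorem cobaseChangeId_inv_right {f : X ⟶ X} (hf : f = 𝟙 X) (n : EtaleUnder E X) :
    ((cobaseChangeId hf).inv.app n).right = toPushout f n :=
  rfl

theorem toPushout_cobaseChangeComp_hom {f : X ⟶ Y} {g : Y ⟶ Z} {h : X ⟶ Z} (w : f ≫ g = h)
    (n : EtaleUnder E X) :
    toPushout f n ≫ toPushout g ((cobaseChange E f).obj n) ≫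
      ((cobaseChangeComp w).hom.app n).right = toPushout h n := by
  refine (congrArg (toPushout f n ≫ ·) (toPushout_desc _ _)).trans ?_
  exact (isPushout f n).inl_desc _ _ _

theorem toPushout_cobaseChangeComp_inv {f : X ⟶ Y} {g : Y ⟶ Z} {h : X ⟶ Z} (w : f ≫ g = h)
    (n : EtaleUnder E X) :
    toPushout h n ≫ ((cobaseChangeComp w).inv.app n).right =
      toPushout f n ≫ toPushout g ((cobaseChange E f).obj n) :=
  toPushout_desc _ _

theorem isPushout_map (f : X ⟶ Y) {n n' : EtaleUnder E X} (m : n ⟶ n') :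
    IsPushout m.right (toPushout f n) (toPushout f n') ((cobaseChange E f).map m).right := by
  refine IsPushout.of_left (h₁₁ := n.hom) (v₁₁ := f) (h₂₁ := ((cobaseChange E f).obj n).hom) ?_
    (toPushout_map f m).symm (isPushout f n)
  rw [EtaleUnder.w, EtaleUnder.w]
  exact isPushout f n'

theorem map_isPushout (f : X ⟶ Y) {n n₁ n₂ q : EtaleUnder E X} {m : n ⟶ n₁} {h : n ⟶ n₂}
    {a : n₁ ⟶ q} {b : n₂ ⟶ q} (sq : IsPushout m.right h.right a.right b.right) :
    IsPushout ((cobaseChange E f).map m) ((cobaseChange E f).map h)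
      ((cobaseChange E f).map a) ((cobaseChange E f).map b) := by
  refine isPushout_of_right ?_
  refine IsPushout.of_top (v₁₁ := toPushout f n) (v₁₂ := toPushout f n₁) (h₁₁ := m.right) ?_ ?_
    (isPushout_map f m)
  · rw [toPushout_map, toPushout_map]
    exact sq.paste_vert (isPushout_map f b)
  · rw [← comp_right, ← comp_right, ← Functor.map_comp, ← Functor.map_comp]
    congr 2
    ext
    exact sq.w

end EtaleUnder
end EtaleUnder

section Geometry

set_option linter.unusedSectionVars false

/-- The families of maps in `T` which are covering for `J` and whose duals lie in `V`. -/
def admissiblePrecoverage {T : Type u} [SmallCategory T] (V : MorphismProperty (Models T))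
    (J : GrothendieckTopology T) : Precoverage T where
  coverings x := {R | Sieve.generate R ∈ J x ∧ ∀ ⦃y : T⦄ (p : y ⟶ x), R p → V ((corep T).map p.op)}

variable (T : Type u) [SmallCategory T] [HasFiniteLimits T]

/-- A geometry for the finite limit theory `T`: a saturated class `V` of maps between finitely
presentable models together with a Grothendieck topology `J` on `T` which is generated by covering
families made of duals of maps in `V`. -/
structure Geometry where
  /-- the class of finitely presentable étale maps -/
  V : MorphismProperty (Models T)
  isSaturated : IsSaturatedClass.{u + 1, u, u} V
  /-- the topology on the syntactic category -/
  J : GrothendieckTopology T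
  generated : J = (admissiblePrecoverage V J).toGrothendieck

variable {T} (G : Geometry T)

namespace Geometry

/-- The maps of models that are pushouts of maps in `V`. -/
abbrev E : MorphismProperty (Models T) := G.V.pushouts

instance : G.E.IsStableUnderComposition := ⟨fun n m => G.isSaturated.pushouts_comp n m⟩

theorem E_id (X : Models T) : G.E (𝟙 X) := G.isSaturated.pushouts_id X

/-- The category `𝒱_X` of finitely presented étale maps under the model `X`. -/
abbrev Et (X : Models T) : Type (u + 1) := EtaleUnder G.E X

/-- `G.IsPushoutOfDual b p m` means that the map `m` under `X` is the pushout along `b` of the dual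
of `p`. -/
def IsPushoutOfDual {X : Models T} {n n' : G.Et X} {x y : T} (b : (corep T).obj (op x) ⟶ n.right)
    (p : y ⟶ x) (m : n ⟶ n') : Prop :=
  ∃ g, IsPushout b ((corep T).map p.op) m.right g

/-- The families `(m_i : n ⟶ n_i)` in `𝒱_X` obtained by pushing out, along a map
`b : T(x, -) ⟶ cod n`, the dual of a covering family of `x` that consists of duals of
maps in `V`. -/
def spectralPrecoverage (X : Models T) : Precoverage (G.Et X)ᵒᵖ where
  coverings n := {R | ∃ (x : T) (b : (corep T).obj (op x) ⟶ n.unop.right),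
    ∃ S ∈ admissiblePrecoverage G.V G.J x,
      (∀ ⦃y : T⦄ (p : y ⟶ x), S p →
        ∃ (n' : (G.Et X)ᵒᵖ) (m : n' ⟶ n), R m ∧ G.IsPushoutOfDual b p m.unop) ∧
      (∀ ⦃n' : (G.Et X)ᵒᵖ⦄ (m : n' ⟶ n), R m →
        ∃ (y : T) (p : y ⟶ x), S p ∧ G.IsPushoutOfDual b p m.unop)}

/-- The spectral topology on `𝒱_Xᵒᵖ`. -/
def spectralTopology (X : Models T) : GrothendieckTopology (G.Et X)ᵒᵖ :=
  (G.spectralPrecoverage X).toGrothendieck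

/-- The spectrum of a set-valued model. -/
abbrev Spec (X : Models T) : Type (u + 1) := Sheaf (G.spectralTopology X) (Type u)

theorem E_of_mem {X : Models T} {n : (G.Et X)ᵒᵖ} {R : Presieve n}
    (hR : R ∈ G.spectralPrecoverage X n) {n' : (G.Et X)ᵒᵖ} {m : n' ⟶ n} (hm : R m) :
    G.E m.unop.right := by
  obtain ⟨x, b, S, hS, -, h⟩ := hR
  obtain ⟨y, p, hp, g, sq⟩ := h m hm
  exact ⟨_, _, _, _, _, hS.2 p hp, sq⟩

theorem exists_isPullback {X : Models T} {n n₁ n₂ : (G.Et X)ᵒᵖ} (m : n₁ ⟶ n) (h : n₂ ⟶ n)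
    (hm : G.E m.unop.right) : ∃ (q : (G.Et X)ᵒᵖ) (b : q ⟶ n₂) (a : q ⟶ n₁),
      IsPullback b a h m ∧
        IsPushout m.unop.right h.unop.right a.unop.right b.unop.right := by
  obtain ⟨q, a, b, sq⟩ := EtaleUnder.exists_isPushout m.unop h.unop hm
  exact ⟨op q, b.op, a.op, (EtaleUnder.isPushout_of_right sq).op, sq⟩

instance (X : Models T) : (G.spectralPrecoverage X).HasPullbacks where
  hasPullbacks_of_mem {n₂ n} R h hR := ⟨fun {n₁ m} hm => by
    obtain ⟨q, b, a, sq, -⟩ := G.exists_isPullback m h (G.E_of_mem hR hm)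
    exact sq.flip.hasPullback⟩

instance (X : Models T) : (G.spectralPrecoverage X).IsStableUnderBaseChange where
  mem_coverings_of_isPullback {ι n n₁} m hR n₂ h q b a sq := by
    have hE : ∀ i, G.E (m i).unop.right := fun i => G.E_of_mem hR ⟨i⟩
    have key : ∀ i, IsPushout h.unop.right (m i).unop.right (b i).unop.right (a i).unop.right :=
      fun i => (EtaleUnder.right_isPushout (hE i) (sq i).unop).flip
    obtain ⟨x, c, S, hS, h₁, h₂⟩ := hR
    have key₂ : ∀ i {y : T} (p : y ⟶ x), G.IsPushoutOfDual c p (m i).unop →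
        G.IsPushoutOfDual (c ≫ h.unop.right) p (b i).unop := by
      rintro i y p ⟨g, sq'⟩
      exact ⟨_, sq'.paste_horiz (key i)⟩
    refine ⟨x, c ≫ h.unop.right, S, hS, fun y p hp => ?_, ?_⟩
    · obtain ⟨_, _, ⟨i⟩, hm⟩ := h₁ p hp
      exact ⟨_, b i, ⟨i⟩, key₂ i p hm⟩
    · rintro _ _ ⟨i⟩
      obtain ⟨y, p, hp, hp'⟩ := h₂ (m i) ⟨i⟩
      exact ⟨y, p, hp, key₂ i p hp'⟩

/-- The pushout functor `𝒱_X ⥤ 𝒱_Y` along a map of models. -/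
noncomputable abbrev push {X Y : Models T} (f : X ⟶ Y) : G.Et X ⥤ G.Et Y :=
  EtaleUnder.cobaseChange G.E f

instance {X Y : Models T} (f : X ⟶ Y) :
    (G.spectralPrecoverage X).PullbacksPreservedBy (G.push f).op where
  preservesPairwisePullbacks_of_mem n R hR := ⟨fun n₁ n₂ m h hm _ => by
    obtain ⟨q, b, a, sq, sq'⟩ := G.exists_isPullback m h (G.E_of_mem hR hm)
    exact preservesLimit_of_preserves_limit_cone sq.flip.isLimit
      ((isLimitMapConePullbackConeEquiv _ sq.flip.w).symm
        (EtaleUnder.map_isPushout f sq').op.flip.isLimit)⟩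

theorem spectralPrecoverage_le_comap {X Y : Models T} (f : X ⟶ Y) :
    G.spectralPrecoverage X ≤ (G.spectralPrecoverage Y).comap (G.push f).op := by
  rintro n R ⟨x, b, S, hS, h₁, h₂⟩
  have key : ∀ {n' : G.Et X} {m : n.unop ⟶ n'} {y : T} {p : y ⟶ x}, G.IsPushoutOfDual b p m →
      G.IsPushoutOfDual (n' := (G.push f).obj n')
        (b ≫ EtaleUnder.toPushout f n.unop) p ((G.push f).map m) := by
    rintro n' m y p ⟨g, sq⟩
    exact ⟨_, sq.paste_horiz (EtaleUnder.isPushout_map f m).flip⟩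
  refine ⟨x, b ≫ EtaleUnder.toPushout f n.unop, S, hS, fun y p hp => ?_, ?_⟩
  · obtain ⟨n', m, hm, hm'⟩ := h₁ p hp
    exact ⟨_, (G.push f).op.map m, Presieve.map_map hm, key hm'⟩
  · rintro _ _ ⟨h⟩
    obtain ⟨y, p, hp, hp'⟩ := h₂ _ h
    exact ⟨y, p, hp, key hp'⟩

instance {X Y : Models T} (f : X ⟶ Y) :
    Functor.IsContinuous (G.push f).op (G.spectralTopology X) (G.spectralTopology Y) :=
  Functor.isContinuous_toGrothendieck_of_pullbacksPreservedBy _ _ _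
    (G.spectralPrecoverage_le_comap f)

/-- The direct image functor of the geometric morphism `Spec f : Spec Y ⟶ Spec X` induced by a map
of models. It is the restriction along the pushout functor. -/
noncomputable abbrev directImage {X Y : Models T} (f : X ⟶ Y) : G.Spec Y ⥤ G.Spec X :=
  (G.push f).op.sheafPushforwardContinuous (Type u) _ _

end Geometry
end Geometry

section Pseudofunctor

namespace Geometry
variable {T : Type u} [SmallCategory T] [HasFiniteLimits T] (G : Geometry T)

/-- The isomorphism of direct image functors for an identity. -/
noncomputable def directImageId {X : Models T} {f : X ⟶ X} (hf : f = 𝟙 X) :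
    G.directImage f ≅ 𝟭 _ :=
  Functor.sheafPushforwardContinuousId' (NatIso.op (EtaleUnder.cobaseChangeId hf).symm) _ _

/-- The isomorphism of direct image functors for a composite. -/
noncomputable def directImageComp {X Y Z : Models T} {f : X ⟶ Y} {g : Y ⟶ Z} {h : X ⟶ Z}
    (w : f ≫ g = h) : G.directImage h ≅ G.directImage g ⋙ G.directImage f :=
  let e : (G.push f).op ⋙ (G.push g).op ≅ (G.push h).op :=
    NatIso.op (EtaleUnder.cobaseChangeComp w).symm
  (Functor.sheafPushforwardContinuousComp' e (Type u) (G.spectralTopology X)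
    (G.spectralTopology Y) (G.spectralTopology Z)).symm

theorem directImage_eqToHom {X Y : Models T} {f f' : X ⟶ Y} (e : f = f')
    (h : (G.directImage f).toCatHom = (G.directImage f').toCatHom) (M : G.Spec Y) (n : G.Et X)
    (t : (G.push f).obj n ⟶ (G.push f').obj n)
    (ht : EtaleUnder.toPushout f n ≫ t.right = EtaleUnder.toPushout f' n) :
    ((eqToHom h).toNatTrans.app M).hom.app (op (op n)) = M.obj.map t.op.op := by
  subst e
  obtain rfl : t = 𝟙 _ := EtaleUnder.cobaseChange_hom_ext (by simpa using ht)
  exact (M.obj.map_id _).symm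

theorem comp_chain {B : Type v} [Category.{w} B] {n a b c d e k g : B} {tk : n ⟶ a} {a₁ : a ⟶ b}
    {a₂ : b ⟶ c} {a₃ : c ⟶ d} {a₄ : d ⟶ e} {tf : n ⟶ k} {tgh : k ⟶ b} {g' : B} {tg : k ⟶ g}
    {th : g ⟶ c} {x : g ⟶ g'} {th' : g' ⟶ d} {tfg : n ⟶ g'} {r : n ⟶ e}
    (h₁ : tk ≫ a₁ = tf ≫ tgh) (h₂ : tgh ≫ a₂ = tg ≫ th) (h₃ : th ≫ a₃ = x ≫ th')
    (h₃' : tf ≫ tg ≫ x = tfg) (h₄ : tfg ≫ th' ≫ a₄ = r) : tk ≫ a₁ ≫ a₂ ≫ a₃ ≫ a₄ = r := by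
  rw [← h₄, ← h₃', reassoc_of% h₁, reassoc_of% h₂, reassoc_of% h₃]
  simp

theorem directImage_assoc {X Y Z W : Models T} {f : X ⟶ Y} {g : Y ⟶ Z} {h : Z ⟶ W}
    {fg : X ⟶ Z} {gh : Y ⟶ W} {k k' : X ⟶ W} (hfg : f ≫ g = fg) (hgh : g ≫ h = gh)
    (hk : f ≫ gh = k) (hk' : fg ≫ h = k') (e : (G.directImage k).toCatHom = (G.directImage k').toCatHom) :
    (G.directImageComp hk).hom ≫ Functor.whiskerRight (G.directImageComp hgh).hom (G.directImage f) ≫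
      (Functor.associator _ _ _).hom ≫
        Functor.whiskerLeft (G.directImage h) (G.directImageComp hfg).inv ≫
          (G.directImageComp hk').inv = (eqToHom e).toNatTrans := by
  refine NatTrans.ext (funext fun M => ObjectProperty.hom_ext _ (NatTrans.ext (funext ?_)))
  rintro ⟨⟨n⟩⟩
  have hkk : k = k' := by rw [← hk, ← hgh, ← hk', ← hfg, Category.assoc]
  let a₁ := (EtaleUnder.cobaseChangeComp (E := G.E) hk).inv.app n
  let a₂ := (EtaleUnder.cobaseChangeComp (E := G.E) hgh).inv.app ((G.push f).obj n)
  let a₃ := (G.push h).map ((EtaleUnder.cobaseChangeComp (E := G.E) hfg).hom.app n)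
  let a₄ := (EtaleUnder.cobaseChangeComp (E := G.E) hk').hom.app n
  refine Eq.trans ?_ (G.directImage_eqToHom hkk e M n (a₁ ≫ a₂ ≫ a₃ ≫ a₄) ?_).symm
  · change M.obj.map a₁.op.op ≫ M.obj.map a₂.op.op ≫ 𝟙 _ ≫ M.obj.map a₃.op.op ≫
      M.obj.map a₄.op.op = _
    rw [Category.id_comp, ← Functor.map_comp, ← Functor.map_comp, ← Functor.map_comp]
    rfl
  · have h₁ := EtaleUnder.toPushout_cobaseChangeComp_inv (E := G.E) hk n
    have h₂ := EtaleUnder.toPushout_cobaseChangeComp_inv (E := G.E) hgh ((G.push f).obj n)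
    have h₃ := EtaleUnder.toPushout_map (E := G.E) h
      ((EtaleUnder.cobaseChangeComp (E := G.E) hfg).hom.app n)
    have h₃' := EtaleUnder.toPushout_cobaseChangeComp_hom (E := G.E) hfg n
    have h₄ := EtaleUnder.toPushout_cobaseChangeComp_hom (E := G.E) hk' n
    exact comp_chain h₁ h₂ h₃ h₃' h₄

theorem directImage_id_comp {X Y : Models T} {i : X ⟶ X} {f k : X ⟶ Y} (hi : i = 𝟙 X)
    (hk : i ≫ f = k) (e : (G.directImage k).toCatHom = (G.directImage f).toCatHom) :
    (G.directImageComp hk).hom ≫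
      Functor.whiskerLeft (G.directImage f) (G.directImageId hi).hom ≫
        (Functor.rightUnitor _).hom = (eqToHom e).toNatTrans := by
  refine NatTrans.ext (funext fun M => ObjectProperty.hom_ext _ (NatTrans.ext (funext ?_)))
  rintro ⟨⟨n⟩⟩
  have hkk : k = f := by rw [← hk, hi, Category.id_comp]
  let a₁ := (EtaleUnder.cobaseChangeComp (E := G.E) hk).inv.app n
  let a₂ := (G.push f).map ((EtaleUnder.cobaseChangeId (E := G.E) hi).hom.app n)
  refine Eq.trans ?_ (G.directImage_eqToHom hkk e M n (a₁ ≫ a₂) ?_).symm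
  · change M.obj.map a₁.op.op ≫ M.obj.map a₂.op.op ≫ 𝟙 _ = _
    rw [Category.comp_id, ← Functor.map_comp]
    rfl
  · have h₁ := EtaleUnder.toPushout_cobaseChangeComp_inv (E := G.E) hk n
    have h₂ := EtaleUnder.toPushout_map (E := G.E) f
      ((EtaleUnder.cobaseChangeId (E := G.E) hi).hom.app n)
    have h₃ := EtaleUnder.toPushout_cobaseChangeId_hom (E := G.E) hi n
    change _ ≫ a₁.right ≫ a₂.right = _
    refine (Category.assoc _ _ _).symm.trans ((congrArg (· ≫ _) h₁).trans ?_)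
    refine (Category.assoc _ _ _).trans ((congrArg (_ ≫ ·) h₂).trans ?_)
    exact (Category.assoc _ _ _).symm.trans ((congrArg (· ≫ _) h₃).trans (Category.id_comp _))

theorem directImage_comp_id {X Y : Models T} {i : Y ⟶ Y} {f k : X ⟶ Y} (hi : i = 𝟙 Y)
    (hk : f ≫ i = k) (e : (G.directImage k).toCatHom = (G.directImage f).toCatHom) :
    (G.directImageComp hk).hom ≫
      Functor.whiskerRight (G.directImageId hi).hom (G.directImage f) ≫
        (Functor.leftUnitor _).hom = (eqToHom e).toNatTrans := by
  refine NatTrans.ext (funext fun M => ObjectProperty.hom_ext _ (NatTrans.ext (funext ?_)))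
  rintro ⟨⟨n⟩⟩
  have hkk : k = f := by rw [← hk, hi, Category.comp_id]
  let a₁ := (EtaleUnder.cobaseChangeComp (E := G.E) hk).inv.app n
  let a₂ := (EtaleUnder.cobaseChangeId (E := G.E) hi).hom.app ((G.push f).obj n)
  refine Eq.trans ?_ (G.directImage_eqToHom hkk e M n (a₁ ≫ a₂) ?_).symm
  · change M.obj.map a₁.op.op ≫ M.obj.map a₂.op.op ≫ 𝟙 _ = _
    rw [Category.comp_id, ← Functor.map_comp]
    rfl
  · have h₁ := EtaleUnder.toPushout_cobaseChangeComp_inv (E := G.E) hk n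
    have h₂ := EtaleUnder.toPushout_cobaseChangeId_hom (E := G.E) hi ((G.push f).obj n)
    change _ ≫ a₁.right ≫ a₂.right = _
    refine (Category.assoc _ _ _).symm.trans ((congrArg (· ≫ _) h₁).trans ?_)
    exact (Category.assoc _ _ _).trans ((congrArg (_ ≫ ·) h₂).trans (Category.comp_id _))

variable {C : Type u} [SmallCategory C] (P : Cᵒᵖ ⥤ Models T)

/-- The pseudofunctor taking `c` to the spectrum of the model `P(c)` and a morphism `s : c ⟶ c'` to
the direct image functor of the geometric morphism `Spec P(c) ⟶ Spec P(c')`. -/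
noncomputable def spectralPseudofunctor : Pseudofunctor (LocallyDiscrete (Cᵒᵖ)ᵒᵖ) Cat.{u + 1, u + 1} :=
  LocallyDiscrete.mkPseudofunctor
    (fun c => Cat.of (G.Spec (P.obj c.unop)))
    (fun s => (G.directImage (P.map s.unop)).toCatHom)
    (fun c => Cat.Hom.isoMk (G.directImageId (P.map_id c.unop)))
    (fun s t => Cat.Hom.isoMk (G.directImageComp (P.map_comp t.unop s.unop).symm))
    (fun _ _ _ => Cat.Hom₂.ext (G.directImage_assoc _ _ _ _ _))
    (fun _ => Cat.Hom₂.ext (G.directImage_comp_id _ _ _))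
    (fun _ => Cat.Hom₂.ext (G.directImage_id_comp _ _ _))


end Geometry
end Pseudofunctor

section Sections

/-- The data of a section of the fibration over `S` associated to a contravariant pseudofunctor
`D`, without functoriality. -/
structure FibSectionData {S : Type u} [Category.{v} S]
    (D : Pseudofunctor (LocallyDiscrete Sᵒᵖ) Cat.{w, w}) where
  /-- the value at an object, which lies in the fibre over this object -/
  obj (a : S) : D.obj ⟨op a⟩
  /-- the fibre component of the value at a morphism -/
  map {a b : S} (s : a ⟶ b) : obj a ⟶ (D.map s.op.toLoc).toFunctor.obj (obj b)

section
variable {S : Type u} [Category.{v} S] {D : Pseudofunctor (LocallyDiscrete Sᵒᵖ) Cat.{w, w}}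

/-- The value at an object, as an object of the total category. -/
def FibSectionData.point (X : FibSectionData D) (a : S) : Pseudofunctor.CoGrothendieck D :=
  ⟨a, X.obj a⟩

/-- The value at a morphism, as a morphism of the total category. -/
def FibSectionData.arrow (X : FibSectionData D) {a b : S} (s : a ⟶ b) : X.point a ⟶ X.point b :=
  Pseudofunctor.CoGrothendieck.Hom.mk s (X.map s)

end

/-- A section of the fibration over `S` associated to a contravariant pseudofunctor `D`. -/
structure FibSection {S : Type u} [Category.{v} S]
    (D : Pseudofunctor (LocallyDiscrete Sᵒᵖ) Cat.{w, w}) extends FibSectionData D where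
  map_id (a : S) : toFibSectionData.arrow (𝟙 a) = 𝟙 (toFibSectionData.point a)
  map_comp {a b c : S} (s : a ⟶ b) (t : b ⟶ c) :
    toFibSectionData.arrow (s ≫ t) = toFibSectionData.arrow s ≫ toFibSectionData.arrow t

namespace FibSection
variable {S : Type u} [Category.{v} S] {D : Pseudofunctor (LocallyDiscrete Sᵒᵖ) Cat.{w, w}}

/-- A section as a functor to the total category. -/
def toFunctor (X : FibSection D) : S ⥤ Pseudofunctor.CoGrothendieck D where
  obj := X.point
  map := X.arrow
  map_id := X.map_id
  map_comp := X.map_comp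

theorem toFunctor_forget (X : FibSection D) :
    X.toFunctor ⋙ Pseudofunctor.CoGrothendieck.forget D = 𝟭 S := rfl

/-- A morphism of sections: a natural transformation with vertical components. -/
@[ext]
structure Hom (X Y : FibSection D) where
  /-- the components -/
  app (a : S) : X.obj a ⟶ Y.obj a
  naturality {a b : S} (s : a ⟶ b) :
    X.map s ≫ (D.map s.op.toLoc).toFunctor.map (app b) = app a ≫ Y.map s

instance : Category (FibSection D) where
  Hom := Hom
  id X := ⟨fun a => 𝟙 (X.obj a), fun s => by
    rw [CategoryTheory.Functor.map_id, Category.comp_id, Category.id_comp]⟩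
  comp f g := ⟨fun a => f.app a ≫ g.app a, fun s => by
    rw [Functor.map_comp, ← Category.assoc, f.naturality, Category.assoc, g.naturality,
      Category.assoc]⟩
  id_comp f := Hom.ext (funext fun a => Category.id_comp _)
  comp_id f := Hom.ext (funext fun a => Category.comp_id _)
  assoc f g h := Hom.ext (funext fun a => Category.assoc _ _ _)

/-- For composable `s : a ⟶ b` and `t : b ⟶ c`, the map `D(s)(X b) ⟶ D(s ≫ t)(X c)` induced by the
value of the section `X` at `t`. -/
def transition (X : FibSection D) {a b c : S} (s : a ⟶ b) (t : b ⟶ c) (st : a ⟶ c)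
    (h : s ≫ t = st) :
    (D.map s.op.toLoc).toFunctor.obj (X.obj b) ⟶ (D.map st.op.toLoc).toFunctor.obj (X.obj c) :=
  (D.map s.op.toLoc).toFunctor.map (X.map t) ≫
    (D.mapComp' t.op.toLoc s.op.toLoc st.op.toLoc (by rw [← h, op_comp]; rfl)).inv.toNatTrans.app (X.obj c)

end FibSection

section Continuous
variable {C : Type u} [SmallCategory C] [HasFiniteLimits C] (J : GrothendieckTopology C)
  {D : Pseudofunctor (LocallyDiscrete (Cᵒᵖ)ᵒᵖ) Cat.{w, w}}
  [∀ c, HasProducts.{u} (D.obj c)] (X : FibSection D)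

namespace FibSection

/-- `X c ⟶ ∏ i, D(s i) (X (c i))`. -/
noncomputable def descentι {c : C} {I : Type u} {d : I → C} (s : ∀ i, d i ⟶ c) :
    X.obj (op c) ⟶ ∏ᶜ fun i => (D.map (s i).op.op.toLoc).toFunctor.obj (X.obj (op (d i))) :=
  Pi.lift fun i => X.map (s i).op

/-- The map `∏ i, D(s i) (X (d i)) ⟶ ∏ (i, j), D(s i j) (X (d i ×[c] d j))` given by the first
projections, where `s i j` is the map from `d i ×[c] d j` to `c`. -/
noncomputable def descentFst {c : C} {I : Type u} {d : I → C} (s : ∀ i, d i ⟶ c) :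
    (∏ᶜ fun i => (D.map (s i).op.op.toLoc).toFunctor.obj (X.obj (op (d i)))) ⟶
      ∏ᶜ fun p : I × I => (D.map (pullback.fst (s p.1) (s p.2) ≫ s p.1).op.op.toLoc).toFunctor.obj
        (X.obj (op (pullback (s p.1) (s p.2)))) :=
  Pi.lift fun p => Pi.π _ p.1 ≫ X.transition (s p.1).op (pullback.fst (s p.1) (s p.2)).op _ rfl

/-- The same with the second projections. -/
noncomputable def descentSnd {c : C} {I : Type u} {d : I → C} (s : ∀ i, d i ⟶ c) :
    (∏ᶜ fun i => (D.map (s i).op.op.toLoc).toFunctor.obj (X.obj (op (d i)))) ⟶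
      ∏ᶜ fun p : I × I => (D.map (pullback.fst (s p.1) (s p.2) ≫ s p.1).op.op.toLoc).toFunctor.obj
        (X.obj (op (pullback (s p.1) (s p.2)))) :=
  Pi.lift fun p => Pi.π _ p.2 ≫ X.transition (s p.2).op (pullback.snd (s p.1) (s p.2)).op _
    (by rw [pullback.condition]; rfl)

/-- A section is continuous if, for every covering family `(s i : d i ⟶ c)`, the diagram
`X c ⟶ ∏ i, D(s i) (X (d i)) ⇉ ∏ (i, j), D(s i j) (X (d i ×[c] d j))`
is an equalizer in the fibre over `c`. -/
def IsContinuous : Prop :=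
  ∀ ⦃c : C⦄ ⦃I : Type u⦄ (d : I → C) (s : ∀ i, d i ⟶ c), Sieve.ofArrows d s ∈ J c →
    ∃ w : X.descentι s ≫ X.descentFst s = X.descentι s ≫ X.descentSnd s,
      Nonempty (IsLimit (Fork.ofι (X.descentι s) w))

end FibSection

variable (D) in
/-- The category of continuous sections. -/
abbrev ContinuousSections :=
  ObjectProperty.FullSubcategory fun X : FibSection D => X.IsContinuous J

end Continuous
end Sections

section Total

namespace Geometry
variable {T : Type u} [SmallCategory T] [HasFiniteLimits T] (G : Geometry T)
variable {C : Type u} [SmallCategory C]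

/-- The objects `(c, l)` with `l` a finitely presented étale map under `P(c)`. -/
structure Total (P : Cᵒᵖ ⥤ Models T) where
  /-- the base object -/
  base : C
  /-- the étale map -/
  fiber : G.Et (P.obj (op base))

variable {G} {P : Cᵒᵖ ⥤ Models T}

namespace Total

/-- A morphism `(c, l) ⟶ (c', l')`: a map `s : c' ⟶ c` and a map `h` between the codomains of `l`
and `l'` such that `l ≫ h = P(s) ≫ l'`. -/
@[ext]
structure Hom (X Y : G.Total P) where
  /-- the map between the base objects -/
  base : Y.base ⟶ X.base
  /-- the map between the codomains -/
  right : X.fiber.right ⟶ Y.fiber.right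
  w : X.fiber.hom ≫ right = P.map base.op ≫ Y.fiber.hom

instance : Category (G.Total P) where
  Hom := Hom
  id X := ⟨𝟙 _, 𝟙 _, by simp⟩
  comp f g := ⟨g.base ≫ f.base, f.right ≫ g.right, by
    rw [← Category.assoc, f.w, Category.assoc, g.w, op_comp, P.map_comp, Category.assoc]⟩
  id_comp f := Hom.ext (Category.comp_id _) (Category.id_comp _)
  comp_id f := Hom.ext (Category.id_comp _) (Category.comp_id _)
  assoc f g h := Hom.ext (Category.assoc _ _ _).symm (Category.assoc _ _ _)

end Total

variable (G P)

/-- The inclusion `c ↦ (c, 𝟙)`. -/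
def baseInclusion : C ⥤ (G.Total P)ᵒᵖ where
  obj c := op ⟨c, ⟨_, 𝟙 _, G.E_id _⟩⟩
  map s := Quiver.Hom.op (⟨s, P.map s.op, by simp⟩ : Total.Hom _ _)
  map_id c := congrArg Quiver.Hom.op (Total.Hom.ext rfl (P.map_id _))
  map_comp s t := congrArg Quiver.Hom.op (Total.Hom.ext rfl (P.map_comp _ _))

/-- The inclusion of the fibre over `c`. -/
def fiberInclusion (c : C) : G.Et (P.obj (op c)) ⥤ G.Total P where
  obj n := ⟨c, n⟩
  map m := ⟨𝟙 c, m.right, by simp⟩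
  map_comp f g := Total.Hom.ext (Category.comp_id _).symm rfl

/-- The horizontal families are the images of the covering families in the base, and the
vertical families are the images of the covering families in the fibres. -/
inductive TotalCover (J : GrothendieckTopology C) : ∀ X : (G.Total P)ᵒᵖ, Presieve X → Prop
  | horizontal {c : C} (R : Presieve c) (hR : Sieve.generate R ∈ J c) :
      TotalCover J ((G.baseInclusion P).obj c) (R.map (G.baseInclusion P))
  | vertical (c : C) {n : (G.Et (P.obj (op c)))ᵒᵖ} (R : Presieve n)
      (hR : Sieve.generate R ∈ G.spectralTopology (P.obj (op c)) n) :
      TotalCover J ((G.fiberInclusion P c).op.obj n) (R.map (G.fiberInclusion P c).op)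

/-- The topology of the spectral site generated by the horizontal and the vertical families. -/
def totalTopology (J : GrothendieckTopology C) : GrothendieckTopology (G.Total P)ᵒᵖ :=
  Precoverage.toGrothendieck ⟨fun X => {R | G.TotalCover P J X R}⟩

/-- The spectrum `Sh(𝒱_Fᵒᵖ, J_F)`. -/
abbrev TotalSpec (J : GrothendieckTopology C) : Type (u + 1) :=
  Sheaf (G.totalTopology P J) (Type u)

instance (c) : HasProducts.{u} ((G.spectralPseudofunctor P).obj c) :=
  inferInstanceAs (HasProducts.{u} (G.Spec (P.obj c.as.unop)))

end Geometry
end Total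

/-! The projection from `G.Total P` to the opposite of `C` is an opfibration: pushing an étale map
out along `P.map s.op` gives the cocartesian map `toPushed s n`, and every map is a cocartesian map
followed by a vertical one (`toPushed_vert`). A covariant functor on `G.Total P` therefore amounts
to a functor on each fibre together with compatible transition maps along the cocartesian maps. If
its restriction to each fibre is a sheaf, this is exactly a section of the direct fibration
(`toPresheaf`, `ofPresheaf`). It remains to match the sheaf condition for the total topology with
continuity.

The vertical families account for the fibrewise sheaf condition. Conversely, a fibrewise sheaf
satisfies the sheaf condition for every pullback of a vertical family: pushout functors preserve
spectral covers, so such a pullback contains a vertical cover (`functorPullback_mem`). This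
preservation, which is also the first claim of the theorem, holds because a pushout of a pushout of
a dual map is again a pushout of that dual map.

The pullbacks of the horizontal families are the sieves of all maps lying over a covering sieve of
the base (`pullback_generate_baseInclusion`). Such a sieve on `(c, n)` is generated by the
cocartesian maps `toPushed (s i) n` (`overSieve_ofArrows`), and compatibility for these is tested on
the pushouts of `n` over the fibre products (`compatible_toPushed_iff`). Limits of sheaves are
computed pointwise, so the resulting condition for all `n` is the equalizer condition of continuity
(`isContinuous_iff`). -/

set_option linter.unusedSectionVars false

namespace Geometry

variable {T : Type u} [SmallCategory T] [HasFiniteLimits T] {G : Geometry T}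
variable {C : Type u} [SmallCategory C] {P : Cᵒᵖ ⥤ Models T}

/-! ### Cocartesian maps in the total category -/

namespace Total

@[ext]
theorem hom_ext {X Y : G.Total P} {f g : X ⟶ Y} (h₁ : f.base = g.base) (h₂ : f.right = g.right) :
    f = g :=
  Hom.ext h₁ h₂

@[simp] theorem comp_right {X Y Z : G.Total P} (f : X ⟶ Y) (g : Y ⟶ Z) :
    (f ≫ g).right = f.right ≫ g.right := rfl

/-- The cocartesian map over a map in the base. -/
noncomputable def toPushed {c c' : C} (s : c' ⟶ c) (n : G.Et (P.obj (op c))) :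
    (G.fiberInclusion P c).obj n ⟶
      (G.fiberInclusion P c').obj ((G.push (P.map s.op)).obj n) :=
  ⟨s, EtaleUnder.toPushout _ _, (EtaleUnder.isPushout _ _).w⟩

/-- The vertical part of a map. -/
noncomputable def vert {X Y : G.Total P} (f : X ⟶ Y) :
    (G.push (P.map f.base.op)).obj X.fiber ⟶ Y.fiber :=
  EtaleUnder.cobaseChangeDesc f.right f.w

@[simp]
theorem toPushout_vert {X Y : G.Total P} (f : X ⟶ Y) :
    EtaleUnder.toPushout (P.map f.base.op) X.fiber ≫ (vert f).right = f.right :=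
  EtaleUnder.toPushout_desc _ _

@[simp]
theorem toPushout_vert_assoc {X Y : G.Total P} (f : X ⟶ Y) {W : Models T}
    (t : Y.fiber.right ⟶ W) :
    EtaleUnder.toPushout (P.map f.base.op) X.fiber ≫ (vert f).right ≫ t = f.right ≫ t :=
  EtaleUnder.toPushout_desc_assoc _ _ _

theorem toPushed_vert {X Y : G.Total P} (f : X ⟶ Y) :
    toPushed f.base X.fiber ≫ (G.fiberInclusion P Y.base).map (vert f) = f := by
  ext1
  · exact Category.id_comp _
  · exact toPushout_vert f

theorem map_toPushed {c c' : C} (s : c' ⟶ c) {n m : G.Et (P.obj (op c))} (f : n ⟶ m) :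
    (G.fiberInclusion P c).map f ≫ toPushed s m =
      toPushed s n ≫ (G.fiberInclusion P c').map ((G.push (P.map s.op)).map f) := by
  ext1
  · exact (Category.comp_id _).trans (Category.id_comp _).symm
  · exact (EtaleUnder.toPushout_map _ _).symm

/-- The map between two pushouts of the same object. -/
noncomputable def pushedMap {c c' d : C} (s : c' ⟶ c) (t : d ⟶ c') (r : d ⟶ c) (h : t ≫ s = r)
    (n : G.Et (P.obj (op c))) :
    (G.fiberInclusion P c').obj ((G.push (P.map s.op)).obj n) ⟶
      (G.fiberInclusion P d).obj ((G.push (P.map r.op)).obj n) :=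
  toPushed t ((G.push (P.map s.op)).obj n) ≫ (G.fiberInclusion P d).map
    ((EtaleUnder.cobaseChangeComp (by subst h; exact (P.map_comp _ _).symm)).hom.app n)

theorem pushedMap_base {c c' d : C} (s : c' ⟶ c) (t : d ⟶ c') (r : d ⟶ c) (h : t ≫ s = r)
    (n : G.Et (P.obj (op c))) : (pushedMap s t r h n).base = t :=
  Category.id_comp _

theorem toPushed_pushedMap {c c' d : C} (s : c' ⟶ c) (t : d ⟶ c') (r : d ⟶ c) (h : t ≫ s = r)
    (n : G.Et (P.obj (op c))) : toPushed s n ≫ pushedMap s t r h n = toPushed r n := by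
  ext1
  · exact (congrArg (· ≫ s) (Category.id_comp _)).trans h
  · exact EtaleUnder.toPushout_cobaseChangeComp_hom (by subst h; exact (P.map_comp _ _).symm) n

/-- Vertical parts compose only after pushing the first one forward, and up to the comparison of
iterated pushouts. This is what makes `toPresheaf` respect composition. -/
theorem vert_comp {X Y Z : G.Total P} (f : X ⟶ Y) (g : Y ⟶ Z) :
    (G.push (P.map g.base.op)).map (vert f) ≫ vert g =
      (EtaleUnder.cobaseChangeComp (P.map_comp f.base.op g.base.op).symm).hom.app X.fiber ≫
        vert (f ≫ g) := by
  -- After composing with the inverse comparison, both sides start at a single pushout, and a map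
  -- out of it is determined by its composite with `toPushout`.
  rw [← cancel_epi ((EtaleUnder.cobaseChangeComp
    (P.map_comp f.base.op g.base.op).symm).inv.app X.fiber), Iso.inv_hom_id_app_assoc]
  refine EtaleUnder.cobaseChange_hom_ext ?_
  have h₁ := EtaleUnder.toPushout_cobaseChangeComp_inv (E := G.E)
    (P.map_comp f.base.op g.base.op).symm X.fiber
  have h₂ := EtaleUnder.toPushout_map_assoc (P.map g.base.op) (vert f) (vert g).right
  have h₃ := toPushout_vert (f ≫ g)
  refine Eq.trans ?_ h₃.symm
  refine (Category.assoc _ _ _).symm.trans ((congrArg (· ≫ _) h₁).trans ?_)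
  refine (Category.assoc _ _ _).trans ((congrArg (_ ≫ ·) h₂).trans ?_)
  simp

theorem vert_id (X : G.Total P) :
    vert (𝟙 X) = (EtaleUnder.cobaseChangeId (P.map_id (op X.base))).hom.app X.fiber :=
  rfl

/-- Existence half of the cocartesian property of `toPushed`, from the universal property of the
pushout square; `toPushed_hom_ext` is the uniqueness half. -/
theorem exists_toPushed_comp {c d : C} {n : G.Et (P.obj (op c))} {W : G.Total P}
    (g : (G.fiberInclusion P c).obj n ⟶ W) (s : d ⟶ c) (q : W.base ⟶ d) (e : q ≫ s = g.base) :
    ∃ h : (G.fiberInclusion P d).obj ((G.push (P.map s.op)).obj n) ⟶ W,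
      h.base = q ∧ toPushed s n ≫ h = g := by
  have sq := EtaleUnder.isPushout (P.map s.op) n
  have w : n.hom ≫ g.right = P.map s.op ≫ P.map q.op ≫ W.fiber.hom := by
    refine g.w.trans ?_
    refine (congrArg (fun k => P.map k.op ≫ W.fiber.hom) e.symm).trans ?_
    exact (congrArg (· ≫ W.fiber.hom) (P.map_comp s.op q.op)).trans (Category.assoc _ _ _)
  exact ⟨⟨q, sq.desc g.right _ w, sq.inr_desc _ _ _⟩, rfl, hom_ext e (sq.inl_desc _ _ _)⟩

theorem toPushed_hom_ext {c d : C} {s : d ⟶ c} {n : G.Et (P.obj (op c))} {W : G.Total P}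
    {h h' : (G.fiberInclusion P d).obj ((G.push (P.map s.op)).obj n) ⟶ W}
    (e₁ : h.base = h'.base) (e₂ : toPushed s n ≫ h = toPushed s n ≫ h') : h = h' :=
  hom_ext e₁ ((EtaleUnder.isPushout (P.map s.op) n).hom_ext (congrArg Hom.right e₂)
    (h.w.trans ((congrArg (fun k => P.map k.op ≫ W.fiber.hom) e₁).trans h'.w.symm)))

end Total

/-! ### From sections to presheaves on the total category -/

namespace FibSection

variable (Y : FibSection (G.spectralPseudofunctor P))

/-- The value of a section at an object of the base. -/
abbrev fib (c : C) : G.Spec (P.obj (op c)) := Y.obj (op c)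

/-- The map of sheaves induced by a map of the base. -/
def fibMap {c c' : C} (s : c' ⟶ c) : fib Y c ⟶ (G.directImage (P.map s.op)).obj (fib Y c') :=
  Y.map s.op

/-- The map of values induced by a map of the base. -/
def transit {c c' : C} (s : c' ⟶ c) (n : G.Et (P.obj (op c))) :
    (fib Y c).obj.obj (op (op n)) ⟶
      (fib Y c').obj.obj (op (op ((G.push (P.map s.op)).obj n))) :=
  (fibMap Y s).hom.app (op (op n))

theorem transit_naturality {c c' : C} (s : c' ⟶ c) {n m : G.Et (P.obj (op c))} (f : n ⟶ m) :
    (fib Y c).obj.map f.op.op ≫ transit Y s m =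
      transit Y s n ≫ (fib Y c').obj.map ((G.push (P.map s.op)).map f).op.op :=
  (fibMap Y s).hom.naturality f.op.op

theorem transit_id (c : C) (n : G.Et (P.obj (op c))) :
    transit Y (𝟙 c) n = (fib Y c).obj.map
      ((EtaleUnder.cobaseChangeId (P.map_id (op c))).inv.app n).op.op := by
  -- Equality in the total category of the fibration gives equality of fibre components up to an
  -- `eqToHom`. The base components agree by definition, so this `eqToHom` is an identity.
  obtain ⟨_, h⟩ := (Pseudofunctor.CoGrothendieck.Hom.ext_iff _ _).1 (Y.map_id (op c))
  replace h := h.trans (Category.comp_id _)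
  exact congrArg (fun k : fib Y c ⟶ (G.directImage (P.map (𝟙 (op c)))).obj (fib Y c) =>
    k.hom.app (op (op n))) h

theorem transit_comp {c c' d : C} (s : c' ⟶ c) (t : d ⟶ c') (n : G.Et (P.obj (op c))) :
    transit Y (t ≫ s) n = transit Y s n ≫ transit Y t ((G.push (P.map s.op)).obj n) ≫
      (fib Y d).obj.map
        ((EtaleUnder.cobaseChangeComp (P.map_comp s.op t.op).symm).hom.app n).op.op := by
  obtain ⟨_, h⟩ := (Pseudofunctor.CoGrothendieck.Hom.ext_iff _ _).1 (Y.map_comp s.op t.op)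
  replace h := h.trans (Category.comp_id _)
  exact congrArg (fun k : fib Y c ⟶ (G.directImage (P.map (s.op ≫ t.op))).obj (fib Y d) =>
    k.hom.app (op (op n))) h

/-- The presheaf on the total category associated to a section. -/
noncomputable def toPresheaf : (G.Total P)ᵒᵖᵒᵖ ⥤ Type u where
  obj X := (fib Y X.unop.unop.base).obj.obj (op (op X.unop.unop.fiber))
  map {X X'} f := transit Y f.unop.unop.base X.unop.unop.fiber ≫
    (fib Y X'.unop.unop.base).obj.map (Total.vert f.unop.unop).op.op
  map_id X := by
    refine (congrArg (· ≫ _) (transit_id Y _ _)).trans ?_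
    rw [← Functor.map_comp, ← op_comp, ← op_comp]
    refine Eq.trans ?_ ((fib Y X.unop.unop.base).obj.map_id _)
    congr 3
    exact (congrArg (_ ≫ ·) (Total.vert_id X.unop.unop)).trans (Iso.inv_hom_id_app _ _)
  map_comp {X X' X''} f g := by
    have h₁ := transit_comp Y f.unop.unop.base g.unop.unop.base X.unop.unop.fiber
    have h₂ := transit_naturality Y g.unop.unop.base (Total.vert f.unop.unop)
    have h₃ := congrArg (fun k => (fib Y X''.unop.unop.base).obj.map k.op.op)
      (Total.vert_comp f.unop.unop g.unop.unop)
    simp only [op_comp, Functor.map_comp] at h₃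
    -- The transition of the composite is split by `h₁`, the vertical part of `f` is moved past the
    -- second transition by naturality, and what remains is the image of `vert_comp`.
    refine (congrArg (· ≫ _) h₁).trans ?_
    rw [Category.assoc, Category.assoc, Category.assoc, reassoc_of% h₂, h₃]
    rfl

end FibSection

end Geometry

theorem CategoryTheory.Functor.map_op_op_comp_comp {D : Type*} [Category* D] {E : Type*}
    [Category* E] (X : Dᵒᵖᵒᵖ ⥤ E) {a b c d : D} (f : a ⟶ b) (g : b ⟶ c) (h : c ⟶ d) :
    X.map (f ≫ g ≫ h).op.op = X.map f.op.op ≫ X.map g.op.op ≫ X.map h.op.op := by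
  simp

namespace Geometry

variable {T : Type u} [SmallCategory T] [HasFiniteLimits T] {G : Geometry T}
variable {C : Type u} [SmallCategory C] {P : Cᵒᵖ ⥤ Models T}

namespace FibSection

variable {Y Y' : FibSection (G.spectralPseudofunctor P)}

/-- The component of a morphism of sections at an object of the base. -/
def fibHom (φ : Y ⟶ Y') (c : C) : fib Y c ⟶ fib Y' c := φ.app (op c)

theorem transit_fibHom (φ : Y ⟶ Y') {c c' : C} (s : c' ⟶ c) (n : G.Et (P.obj (op c))) :
    transit Y s n ≫ (fibHom φ c').hom.app (op (op ((G.push (P.map s.op)).obj n))) =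
      (fibHom φ c).hom.app (op (op n)) ≫ transit Y' s n :=
  congrArg (fun k : fib Y c ⟶ (G.directImage (P.map s.op)).obj (fib Y' c') =>
    k.hom.app (op (op n))) (φ.naturality s.op)

theorem toPresheaf_map_toPushed {c c' : C} (s : c' ⟶ c) (n : G.Et (P.obj (op c))) :
    (toPresheaf Y).map (Total.toPushed s n).op.op = transit Y s n := by
  have h : Total.vert (Total.toPushed s n) = 𝟙 _ :=
    EtaleUnder.cobaseChange_hom_ext
      ((Total.toPushout_vert (Total.toPushed s n)).trans (Category.comp_id _).symm)
  refine (congrArg (fun k => transit Y s n ≫ (fib Y c').obj.map k.op.op) h).trans ?_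
  exact (congrArg (_ ≫ ·) ((fib Y c').obj.map_id _)).trans (Category.comp_id _)

/-- The vertical part of a map over `𝟙 c` starts at the pushout along the identity, so it is `f`
preceded by `cobaseChangeId`. The transition along `𝟙 c` contributes the inverse of this
isomorphism, and the two cancel. -/
theorem toPresheaf_map_fiberInclusion {c : C} {n m : G.Et (P.obj (op c))} (f : n ⟶ m) :
    (toPresheaf Y).map ((G.fiberInclusion P c).map f).op.op = (fib Y c).obj.map f.op.op := by
  have h : Total.vert ((G.fiberInclusion P c).map f) =
      (EtaleUnder.cobaseChangeId (P.map_id (op c))).hom.app n ≫ f := by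
    refine EtaleUnder.cobaseChange_hom_ext ?_
    refine (Total.toPushout_vert ((G.fiberInclusion P c).map f)).trans ?_
    have := EtaleUnder.toPushout_cobaseChangeId_hom (E := G.E) (P.map_id (op c)) n
    exact ((Category.id_comp _).symm.trans (congrArg (· ≫ f.right) this.symm)).trans
      (Category.assoc _ _ _)
  refine (congrArg₂ (fun k l => k ≫ (fib Y c).obj.map (Quiver.Hom.op (Quiver.Hom.op l)))
    (transit_id Y c n) h).trans (((fib Y c).obj.map_comp _ _).symm.trans ?_)
  exact congrArg (fun k : n ⟶ m => (fib Y c).obj.map k.op.op)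
    ((EtaleUnder.cobaseChangeId (E := G.E) (P.map_id (op c))).inv_hom_id_app_assoc n f)

/-- The presheaf associated to a section is functorial. -/
noncomputable def toPresheafMap (φ : Y ⟶ Y') : toPresheaf Y ⟶ toPresheaf Y' where
  app X := (fibHom φ X.unop.unop.base).hom.app (op (op X.unop.unop.fiber))
  naturality X X' f := by
    have h₁ := transit_fibHom φ f.unop.unop.base X.unop.unop.fiber
    have h₂ := (fibHom φ X'.unop.unop.base).hom.naturality (Total.vert f.unop.unop).op.op
    refine (Category.assoc _ _ _).trans ((congrArg (_ ≫ ·) h₂).trans ?_)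
    exact (Category.assoc _ _ _).symm.trans ((congrArg (· ≫ _) h₁).trans (Category.assoc _ _ _))

/-- Every map between the presheaves associated to sections comes from a map of sections. -/
def ofPresheafMap (ψ : toPresheaf Y ⟶ toPresheaf Y') : Y ⟶ Y' where
  app a :=
    let k : fib Y a.unop ⟶ fib Y' a.unop :=
      ⟨{ app := fun n => ψ.app (op (op ⟨a.unop, n.unop.unop⟩))
         naturality := fun n m f => by
          have := ψ.naturality ((G.fiberInclusion P a.unop).map f.unop.unop).op.op
          rwa [toPresheaf_map_fiberInclusion, toPresheaf_map_fiberInclusion] at this }⟩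
    k
  naturality {a b} s := by
    refine ObjectProperty.hom_ext _ (NatTrans.ext (funext fun n => ?_))
    -- Naturality at vertical maps made the components maps of sheaves; naturality at cocartesian
    -- maps gives compatibility with the transitions.
    have := ψ.naturality (Total.toPushed s.unop n.unop.unop).op.op
    rw [toPresheaf_map_toPushed, toPresheaf_map_toPushed] at this
    exact this

/-! ### From fibrewise sheaves on the total category to sections -/

section OfPresheaf

variable (X : (G.Total P)ᵒᵖᵒᵖ ⥤ Type u)
  (hX : ∀ c, Presheaf.IsSheaf (G.spectralTopology (P.obj (op c)))
    ((G.fiberInclusion P c).op.op ⋙ X))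

/-- The section associated to a presheaf on the total category, without functoriality. -/
noncomputable def dataOfPresheaf : FibSectionData (G.spectralPseudofunctor P) where
  obj a :=
    let Z : G.Spec (P.obj (op a.unop)) := ⟨(G.fiberInclusion P a.unop).op.op ⋙ X, hX a.unop⟩
    Z
  map {a b} s :=
    let Z : G.Spec (P.obj (op a.unop)) := ⟨(G.fiberInclusion P a.unop).op.op ⋙ X, hX a.unop⟩
    let Z' : G.Spec (P.obj (op b.unop)) := ⟨(G.fiberInclusion P b.unop).op.op ⋙ X, hX b.unop⟩
    let k : Z ⟶ (G.directImage (P.map s.unop.op)).obj Z' :=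
      ⟨{ app := fun n => X.map (Total.toPushed s.unop n.unop.unop).op.op
         naturality := fun n m f => by
          refine (X.map_comp _ _).symm.trans (Eq.trans ?_ (X.map_comp _ _))
          exact congrArg (fun k => X.map (Quiver.Hom.op (Quiver.Hom.op k)))
            (Total.map_toPushed s.unop f.unop.unop) }⟩
    k

/-- The section associated to a presheaf on the total category that restricts to a sheaf on each
fibre. -/
noncomputable def ofPresheaf : FibSection (G.spectralPseudofunctor P) where
  toFibSectionData := dataOfPresheaf X hX
  map_id a := by
    refine Pseudofunctor.CoGrothendieck.Hom.ext _ _ rfl (Eq.trans ?_ (Category.comp_id _).symm)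
    refine ObjectProperty.hom_ext _ (NatTrans.ext (funext fun n => ?_))
    -- Both sides are `X` applied to the map with base component `𝟙` and right component
    -- `toPushout`, because the inverse of `cobaseChangeId` is `toPushout` by definition.
    rfl
  map_comp {a b c} s t := by
    refine Pseudofunctor.CoGrothendieck.Hom.ext _ _ rfl (Eq.trans ?_ (Category.comp_id _).symm)
    refine ObjectProperty.hom_ext _ (NatTrans.ext (funext fun n => ?_))
    -- The cocartesian map over a composite is the composite of two cocartesian maps followed by the
    -- comparison isomorphism in the fibre.
    have := congrArg (fun k => X.map (Quiver.Hom.op (Quiver.Hom.op k)))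
      (Total.toPushed_pushedMap s.unop t.unop _ rfl n.unop.unop)
    refine (this.symm.trans (CategoryTheory.Functor.map_op_op_comp_comp X _ _ _)).trans ?_
    rfl

/-- A presheaf that restricts to a sheaf on each fibre comes from its associated section. -/
noncomputable def toPresheafOfPresheafIso : toPresheaf (ofPresheaf X hX) ≅ X :=
  NatIso.ofComponents (fun Z => Iso.refl _) (fun {Z Z'} f => by
    refine (Category.comp_id _).trans (Eq.trans ?_ (Category.id_comp _).symm)
    refine (X.map_comp _ _).symm.trans ?_
    exact congrArg (fun k => X.map (Quiver.Hom.op (Quiver.Hom.op k)))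
      (Total.toPushed_vert f.unop.unop))

end OfPresheaf

end FibSection

end Geometry

/-- A presheaf whose restriction along `F` is a sheaf for a sieve is a sheaf for the image of this
sieve. -/
theorem CategoryTheory.Presieve.IsSheafFor.functorPushforward {C : Type*} [Category* C] {D : Type*}
    [Category* D] {F : C ⥤ D} {X : Dᵒᵖ ⥤ Type*} {c : C} {S : Sieve c}
    (h : Presieve.IsSheafFor (F.op ⋙ X) S.arrows) :
    Presieve.IsSheafFor X (S.functorPushforward F).arrows := by
  intro x hx
  have mem : ∀ {d} {f : d ⟶ c}, S f → S.functorPushforward F (F.map f) :=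
    fun hf => Sieve.image_mem_functorPushforward F S hf
  obtain ⟨t, ht, hu⟩ := h (fun d f hf => x (F.map f) (mem hf)) (by
    intro Y₁ Y₂ Z g₁ g₂ f₁ f₂ h₁ h₂ e
    exact hx _ _ _ _ ((F.map_comp _ _).symm.trans ((congrArg F.map e).trans (F.map_comp _ _))))
  refine ⟨t, ?_, fun t' ht' => hu _ fun d f hf => ht' _ (mem hf)⟩
  rintro Z _ ⟨d, f, k, hf, rfl⟩
  rw [op_comp, Functor.map_comp_apply]
  refine (congrArg (X.map k.op) (ht f hf)).trans ?_
  -- Compatibility against the identity expresses the family at `k ≫ F.map f` through its value at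
  -- `F.map f`.
  have := hx k (𝟙 Z) (mem hf) ⟨d, f, k, hf, rfl⟩ (Category.id_comp _).symm
  simpa using this

/-- Being separated for a sieve passes to larger presieves. -/
theorem CategoryTheory.Presieve.IsSeparatedFor.of_le {C : Type*} [Category* C]
    {X : Cᵒᵖ ⥤ Type*} {c : C} {S R : Presieve c} (h : Presieve.IsSeparatedFor X S) (hle : S ≤ R) :
    Presieve.IsSeparatedFor X R := by
  rw [Presieve.isSeparatedFor_iff_generate] at h ⊢
  intro x t₁ t₂ h₁ h₂
  exact h.ext fun d f hf => (h₁ f (Sieve.generate_mono hle _ hf)).trans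
    (h₂ f (Sieve.generate_mono hle _ hf)).symm

namespace Geometry

variable {T : Type u} [SmallCategory T] [HasFiniteLimits T] {G : Geometry T}
variable {C : Type u} [SmallCategory C] {P : Cᵒᵖ ⥤ Models T}

/-! ### Vertical families and their pullbacks -/

section Vertical

/-- The given maps lie over `𝟙 c`, so the two legs of any cocone have the same base component. This
supplies the base component of the induced map, and the pushout of models supplies the rest. -/
theorem fiberInclusion_isPushout {c : C} {n n₁ n₂ q : G.Et (P.obj (op c))} {m : n ⟶ n₁}
    {h : n ⟶ n₂} {a : n₁ ⟶ q} {b : n₂ ⟶ q}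
    (sq : IsPushout m.right h.right a.right b.right) :
    IsPushout ((G.fiberInclusion P c).map m) ((G.fiberInclusion P c).map h)
      ((G.fiberInclusion P c).map a) ((G.fiberInclusion P c).map b) where
  w := by
    rw [← Functor.map_comp, ← Functor.map_comp]
    exact congrArg (G.fiberInclusion P c).map (EtaleUnder.hom_ext sq.w)
  isColimit' := ⟨PushoutCocone.IsColimit.mk _
    (fun s => ⟨s.inl.base, sq.desc s.inl.right s.inr.right
      (congrArg Total.Hom.right s.condition), by
        refine Eq.trans ?_ s.inl.w
        refine (congrArg (· ≫ _) (EtaleUnder.w a).symm).trans ((Category.assoc _ _ _).trans ?_)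
        exact congrArg (n₁.hom ≫ ·) (sq.inl_desc _ _ _)⟩)
    (fun s => Total.hom_ext (Category.comp_id _) (sq.inl_desc _ _ _))
    (fun s => Total.hom_ext ((Category.comp_id _).trans
      (((Category.comp_id _).symm.trans (congrArg Total.Hom.base s.condition)).trans
        (Category.comp_id _))) (sq.inr_desc _ _ _))
    (fun s t h₁ h₂ => Total.hom_ext
      ((Category.comp_id _).symm.trans (congrArg Total.Hom.base h₁))
      (sq.hom_ext ((congrArg Total.Hom.right h₁).trans (sq.inl_desc _ _ _).symm)
        ((congrArg Total.Hom.right h₂).trans (sq.inr_desc _ _ _).symm)))⟩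

/-- A sheaf on the total site restricts to a sheaf on each fibre. -/
theorem isSheaf_fiberInclusion {J : GrothendieckTopology C} {X : (G.Total P)ᵒᵖᵒᵖ ⥤ Type u}
    (hX : Presheaf.IsSheaf (G.totalTopology P J) X) (c : C) :
    Presheaf.IsSheaf (G.spectralTopology (P.obj (op c))) ((G.fiberInclusion P c).op.op ⋙ X) := by
  rw [isSheaf_iff_isSheaf_of_type] at hX ⊢
  refine (Precoverage.isSheaf_toGrothendieck_iff_of_isStableUnderBaseChange _).2 fun n R hR => ?_
  have : R.HasPairwisePullbacks := Precoverage.hasPairwisePullbacks_of_mem _ hR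
  -- The fibre inclusion preserves the fibre products of a generating family, so compatibility in
  -- the fibre and in the total category are the same condition.
  have : (G.fiberInclusion P c).op.PreservesPairwisePullbacks R := ⟨fun n₁ n₂ m h hm _ => by
    obtain ⟨q, b, a, sq, sq'⟩ := G.exists_isPullback m h (G.E_of_mem hR hm)
    exact preservesLimit_of_preserves_limit_cone sq.flip.isLimit
      ((isLimitMapConePullbackConeEquiv _ sq.flip.w).symm
        (fiberInclusion_isPushout sq').op.flip.isLimit)⟩
  rw [Presieve.IsSheafFor.comp_iff_of_preservesPairwisePullbacks, Presieve.isSheafFor_iff_generate]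
  exact hX _ (Precoverage.generate_mem_toGrothendieck
    (TotalCover.vertical c R (Precoverage.generate_mem_toGrothendieck hR)))

/-- Pushing `S` forward along the base component of `g` gives a covering sieve, and so does pulling
the result back along the vertical part of `g`. Its members, seen as vertical maps, lie in the
pullback of the image of `S` along `g`. -/
theorem functorPullback_mem {c c' : C} {n : G.Et (P.obj (op c))} {m : G.Et (P.obj (op c'))}
    {S : Sieve (op n)} (hS : S ∈ G.spectralTopology (P.obj (op c)) (op n))
    (g : (G.fiberInclusion P c).obj n ⟶ (G.fiberInclusion P c').obj m) :
    Sieve.functorPullback (X := op m) (G.fiberInclusion P c').op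
      ((S.functorPushforward (G.fiberInclusion P c).op).pullback (X := op _) g.op) ∈
        G.spectralTopology (P.obj (op c')) (op m) := by
  let s : c' ⟶ c := g.base
  let v : (G.push (P.map s.op)).obj n ⟶ m := Total.vert g
  have hS' := (G.spectralTopology (P.obj (op c'))).pullback_stable v.op
    ((CoverPreserving.of_isContinuous (G.push (P.map s.op)).op (G.spectralTopology _)
      (G.spectralTopology _)).cover_preserve hS)
  refine GrothendieckTopology.superset_covering _ ?_ hS'
  rintro ⟨k⟩ f ⟨⟨l⟩, j, h, hj, e⟩
  refine ⟨op l, j, (Total.toPushed g.base l ≫ (G.fiberInclusion P c').map h.unop).op, hj, ?_⟩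
  have e' : Total.vert g ≫ f.unop = (G.push (P.map g.base.op)).map j.unop ≫ h.unop :=
    congrArg Quiver.Hom.unop e
  refine Quiver.Hom.unop_inj ?_
  change g ≫ (G.fiberInclusion P c').map f.unop = (G.fiberInclusion P c).map j.unop ≫
    Total.toPushed g.base l ≫ (G.fiberInclusion P c').map h.unop
  refine (congrArg (· ≫ _) (Total.toPushed_vert g).symm).trans ((Category.assoc _ _ _).trans ?_)
  refine (congrArg (_ ≫ ·) (((G.fiberInclusion P c').map_comp _ _).symm.trans
    ((congrArg _ e').trans ((G.fiberInclusion P c').map_comp _ _)))).trans ?_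
  refine (Category.assoc _ _ _).symm.trans (Eq.trans ?_ (Category.assoc _ _ _))
  exact congrArg (· ≫ _) (Total.map_toPushed g.base j.unop).symm

/-- A presheaf on the total category that is a sheaf on each fibre is a sheaf for the pullbacks of
the vertical families. -/
theorem isSheafFor_pullback_functorPushforward {X : (G.Total P)ᵒᵖᵒᵖ ⥤ Type u}
    (hX : ∀ c, Presieve.IsSheaf (G.spectralTopology (P.obj (op c)))
      ((G.fiberInclusion P c).op.op ⋙ X)) {c : C} {n : G.Et (P.obj (op c))}
    {S : Sieve (op n)} (hS : S ∈ G.spectralTopology (P.obj (op c)) (op n)) {Z : G.Total P}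
    (f : (G.fiberInclusion P c).obj n ⟶ Z) :
    Presieve.IsSheafFor X
      ((S.functorPushforward (G.fiberInclusion P c).op).pullback (X := op _) f.op).arrows := by
  have hS' := functorPullback_mem (m := Z.fiber) hS f
  -- The subsieve generated by the vertical members comes from a cover of the fibre, so `X` is a
  -- sheaf for it. Separatedness for its further pullbacks follows by applying `functorPullback_mem`
  -- again, now to that cover.
  refine Presieve.isSheafFor_subsieve_aux X ?_
    (Presieve.IsSheafFor.functorPushforward (hX Z.base _ hS')) ?_
  · exact (Sieve.functor_galoisConnection (G.fiberInclusion P Z.base).op (op Z.fiber)).l_u_le _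
  · rintro ⟨W⟩ g -
    have hS'' := functorPullback_mem (m := W.fiber) hS' g.unop
    refine (Presieve.IsSheafFor.functorPushforward (hX W.base _ hS'')).isSeparatedFor.of_le ?_
    exact (Sieve.functor_galoisConnection (G.fiberInclusion P W.base).op (op W.fiber)).l_u_le _

end Vertical

/-! ### Pullbacks of horizontal families -/

section Horizontal

/-- The sieve of the maps of the total category that lie over a sieve in the base. -/
def overSieve {c : C} (n : G.Et (P.obj (op c))) (S : Sieve c) :
    Sieve (op ((G.fiberInclusion P c).obj n)) where
  arrows _ f := S f.unop.base
  downward_closed hf g := S.downward_closed hf g.unop.base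

/-- In the total category, a map out of `(c, 𝟙)` is determined by its base component, and every base
component occurs. Membership in the sieve is thus a condition on the base alone. -/
theorem pullback_generate_baseInclusion {c : C} (R : Presieve c) {Z : G.Total P}
    (f : op Z ⟶ (G.baseInclusion P).obj c) :
    (Sieve.generate (R.map (G.baseInclusion P))).pullback f =
      overSieve Z.fiber ((Sieve.generate R).pullback f.unop.base) := by
  ext W g
  constructor
  · rintro ⟨_, h, _, ⟨hr⟩, e⟩
    exact ⟨_, h.unop.base, _, hr, congrArg (fun k => k.unop.base) e⟩
  · rintro ⟨d, q, r, hr, e⟩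
    let k : (G.baseInclusion P).obj d ⟶ (G.baseInclusion P).obj c := (G.baseInclusion P).map r
    let h : W ⟶ (G.baseInclusion P).obj d :=
      Quiver.Hom.op ⟨q, P.map q.op ≫ W.unop.fiber.hom, Category.id_comp _⟩
    refine ⟨_, h, k, Presieve.map_map hr, Quiver.Hom.unop_inj (Total.hom_ext e ?_)⟩
    refine Eq.trans ?_ ((f.unop ≫ g.unop).w.symm.trans (Category.id_comp _))
    refine Eq.trans ?_ (congrArg (fun k => P.map k.op ≫ W.unop.fiber.hom) e)
    exact (Category.assoc _ _ _).symm.trans (congrArg (· ≫ _) (P.map_comp _ _).symm)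

/-- A map whose base component factors through `s i` factors through the cocartesian map over `s i`.
This reduces the sieve to the family that appears in the descent diagram. -/
theorem overSieve_ofArrows {c : C} {I : Type*} {d : I → C} (s : ∀ i, d i ⟶ c)
    (n : G.Et (P.obj (op c))) :
    overSieve n (Sieve.ofArrows d s) =
      Sieve.generate (Presieve.ofArrows _ fun i => (Total.toPushed (s i) n).op) := by
  ext _ g
  constructor
  · rintro ⟨_, q, _, ⟨i⟩, e⟩
    obtain ⟨h, -, hh⟩ := Total.exists_toPushed_comp g.unop (s i) q e
    exact ⟨_, h.op, _, ⟨i⟩, Quiver.Hom.unop_inj hh⟩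
  · rintro ⟨_, q, _, ⟨i⟩, rfl⟩
    exact ⟨_, q.unop.base, _, ⟨i⟩, rfl⟩

end Horizontal

end Geometry

/-- A fork of sheaves of types with a product as its middle term is a limit if and only if every
compatible family of sections has a unique amalgamation. -/
theorem CategoryTheory.Sheaf.isLimit_fork_iff {D : Type*} [Category* D] {K : GrothendieckTopology D}
    {A : Sheaf K (Type u)} {I I' : Type u} {B : I → Sheaf K (Type u)} {B' : I' → Sheaf K (Type u)}
    (a : ∀ i, A ⟶ B i) (j k : I' → I) (f : ∀ p, B (j p) ⟶ B' p) (g : ∀ p, B (k p) ⟶ B' p)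
    (h : ∀ p, a (j p) ≫ f p = a (k p) ≫ g p) :
    (∃ w : Pi.lift a ≫ Pi.lift (fun p => Pi.π B (j p) ≫ f p) =
        Pi.lift a ≫ Pi.lift (fun p => Pi.π B (k p) ≫ g p),
      Nonempty (IsLimit (Fork.ofι (Pi.lift a) w))) ↔
    ∀ (n : Dᵒᵖ) (y : ∀ i, (B i).obj.obj n),
      (∀ p, (f p).hom.app n (y (j p)) = (g p).hom.app n (y (k p))) →
        ∃! x : A.obj.obj n, ∀ i, (a i).hom.app n x = y i := by
  generalize hu : Pi.lift (fun p => Pi.π B (j p) ≫ f p) = u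
  generalize hv : Pi.lift (fun p => Pi.π B (k p) ≫ g p) = v
  have w : Pi.lift a ≫ u = Pi.lift a ≫ v := by
    subst hu hv
    ext1 p
    simpa using h p
  let Φ (n : Dᵒᵖ) : Sheaf K (Type u) ⥤ Type u := sheafToPresheaf K _ ⋙ (evaluation _ _).obj n
  have w' (n : Dᵒᵖ) : (Φ n).map (Pi.lift a) ≫ (Φ n).map u = (Φ n).map (Pi.lift a) ≫ (Φ n).map v := by
    rw [← Functor.map_comp, w, Functor.map_comp]
  -- Evaluation of sheaves at `n` preserves limits, and the evaluations at all `n` jointly reflect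
  -- them.
  have key : Nonempty (IsLimit (Fork.ofι (Pi.lift a) w)) ↔
      ∀ n, Nonempty (IsLimit (Fork.ofι ((Φ n).map (Pi.lift a)) (w' n))) := by
    refine ⟨fun ⟨l⟩ n => ⟨isLimitForkMapOfIsLimit (Φ n) w l⟩, fun l => ⟨?_⟩⟩
    refine isLimitOfReflects (sheafToPresheaf K _) (evaluationJointlyReflectsLimits _ fun n => ?_)
    exact (isLimitMapConeForkEquiv (Φ n) w).symm (l n).some
  rw [exists_prop_of_true w, key]
  refine forall_congr' fun n => ?_
  -- The sections at `n` of a product of sheaves are the families of sections, with the projections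
  -- as coordinates.
  have hE {I : Type u} (B : I → Sheaf K (Type u)) :
      ∃ E : (Φ n).obj (∏ᶜ B) ≃ ∀ i, (Φ n).obj (B i), ∀ z i, E z i = (Φ n).map (Pi.π B i) z := by
    refine ⟨(PreservesProduct.iso (Φ n) B ≪≫ Types.productIso _).toEquiv, fun z i => ?_⟩
    have := Types.productIso_hom_comp_eval (fun i => (Φ n).obj (B i)) i
    have h₂ := piComparison_comp_π (Φ n) B i
    rw [← this] at h₂
    exact ConcreteCategory.congr_hom h₂ z
  obtain ⟨E, hE₁⟩ := hE B
  obtain ⟨E', hE₂⟩ := hE B'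
  have hf (z) (p) : E' ((Φ n).map u z) p = (f p).hom.app n (E z (j p)) := by
    rw [hE₁, hE₂, ← ConcreteCategory.comp_apply, ← Functor.map_comp, ← hu, Pi.lift_π]
    rfl
  have hg (z) (p) : E' ((Φ n).map v z) p = (g p).hom.app n (E z (k p)) := by
    rw [hE₁, hE₂, ← ConcreteCategory.comp_apply, ← Functor.map_comp, ← hv, Pi.lift_π]
    rfl
  have ha (x) (i) : E ((Φ n).map (Pi.lift a) x) i = (a i).hom.app n x := by
    rw [hE₁, ← ConcreteCategory.comp_apply, ← Functor.map_comp, Pi.lift_π]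
    rfl
  refine (Types.type_equalizer_iff_unique _ _).trans (E.forall_congr fun z => ?_)
  refine imp_congr ?_ (existsUnique_congr fun x => ?_)
  · rw [← E'.injective.eq_iff, funext_iff]
    simp only [hf, hg]
  · rw [← E.injective.eq_iff, funext_iff]
    simp only [ha]

theorem FibSection.transition_eq {S : Type u} [Category.{v} S]
    {D : Pseudofunctor (LocallyDiscrete Sᵒᵖ) Cat.{w, w}} (X : FibSection D) {a b c : S} (s : a ⟶ b)
    (t : b ⟶ c) : X.transition s t (s ≫ t) rfl =
      (D.map s.op.toLoc).toFunctor.map (X.map t) ≫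
        (D.mapComp t.op.toLoc s.op.toLoc).inv.toNatTrans.app (X.obj c) := by
  rw [← D.mapComp'_eq_mapComp]
  rfl

/-! ### Continuity as a sheaf condition for cocartesian families -/

namespace Geometry

variable {T : Type u} [SmallCategory T] [HasFiniteLimits T] {G : Geometry T}
variable {C : Type u} [SmallCategory C] {P : Cᵒᵖ ⥤ Models T}

namespace FibSection

variable (Y : FibSection (G.spectralPseudofunctor P))

/-- The transition maps of a section, as maps of sheaves. -/
noncomputable def fibTransition {c c' d : C} (s : c' ⟶ c) (t : d ⟶ c') (r : d ⟶ c) (h : t ≫ s = r) :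
    (G.directImage (P.map s.op)).obj (fib Y c') ⟶ (G.directImage (P.map r.op)).obj (fib Y d) :=
  Y.transition s.op t.op r.op (congrArg Quiver.Hom.op h)

/-- `pushedMap` is a cocartesian map followed by the comparison isomorphism. The presheaf acts on
the first by `transit` and on the second through the fibre, which are the two factors of
`transition`. -/
theorem fibTransition_app {c c' d : C} (s : c' ⟶ c) (t : d ⟶ c') (r : d ⟶ c) (h : t ≫ s = r)
    (n : G.Et (P.obj (op c))) : (fibTransition Y s t r h).hom.app (op (op n)) =
      (toPresheaf Y).map (Total.pushedMap s t r h n).op.op := by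
  subst h
  have h₁ := congrArg (fun k : (G.directImage (P.map s.op)).obj (fib Y c') ⟶
    (G.directImage (P.map (s.op ≫ t.op))).obj (fib Y d) => k.hom.app (op (op n)))
    (Y.transition_eq s.op t.op)
  have h₂ := congrArg₂ (· ≫ ·) (toPresheaf_map_toPushed (Y := Y) t _)
    (toPresheaf_map_fiberInclusion (Y := Y)
      ((EtaleUnder.cobaseChangeComp (P.map_comp s.op t.op).symm).hom.app n))
  exact h₁.trans (h₂.symm.trans ((toPresheaf Y).map_comp _ _).symm)

/-- The pushout of `n` over `d i ×[c] d j` is a pushout, in the total category, of the cocartesian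
maps over `s i` and `s j`. Hence agreement there implies agreement on every test object. -/
theorem compatible_toPushed_iff [HasPullbacks C] {X : (G.Total P)ᵒᵖᵒᵖ ⥤ Type u} {c : C}
    {I : Type u} {d : I → C}
    (s : ∀ i, d i ⟶ c) (n : G.Et (P.obj (op c)))
    (x : ∀ i, X.obj (op (op ((G.fiberInclusion P (d i)).obj ((G.push (P.map (s i).op)).obj n))))) :
    Presieve.Arrows.Compatible X (fun i => (Total.toPushed (s i) n).op) x ↔
      ∀ p : I × I, X.map (Total.pushedMap (s p.1) (pullback.fst (s p.1) (s p.2)) _ rfl n).op.op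
          (x p.1) =
        X.map (Total.pushedMap (s p.2) (pullback.snd (s p.1) (s p.2)) _
          pullback.condition.symm n).op.op (x p.2) := by
  refine ⟨fun h p => h p.1 p.2 _ _ _ ?_, fun h i j W gi gj e => ?_⟩
  · refine Quiver.Hom.unop_inj ?_
    exact (Total.toPushed_pushedMap _ _ _ rfl n).trans
      (Total.toPushed_pushedMap _ _ _ pullback.condition.symm n).symm
  · have e' : Total.toPushed (s i) n ≫ gi.unop = Total.toPushed (s j) n ≫ gj.unop :=
      congrArg Quiver.Hom.unop e
    have eb : gi.unop.base ≫ s i = gj.unop.base ≫ s j := congrArg Total.Hom.base e'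
    let a := Total.pushedMap (s i) (pullback.fst (s i) (s j)) _ rfl n
    let b := Total.pushedMap (s j) (pullback.snd (s i) (s j)) _ pullback.condition.symm n
    -- The common composite lies over a map that factors through the fibre product, so it factors
    -- through the cocartesian map over `d i ×[c] d j ⟶ c`. Uniqueness for cocartesian maps then
    -- recovers `gi` and `gj` from `k`.
    obtain ⟨k, hk, hk'⟩ : ∃ k : (G.fiberInclusion P _).obj ((G.push _).obj n) ⟶ W.unop, _ :=
      Total.exists_toPushed_comp (Total.toPushed (s i) n ≫ gi.unop)
        (pullback.fst (s i) (s j) ≫ s i) (pullback.lift gi.unop.base gj.unop.base eb)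
        (pullback.lift_fst_assoc _ _ _ _)
    have hi : gi.unop = a ≫ k := by
      refine Total.toPushed_hom_ext ?_ ?_
      · exact (congrArg₂ (· ≫ ·) hk (Total.pushedMap_base _ _ _ _ n)).trans
          (pullback.lift_fst _ _ _) |>.symm
      · rw [← Category.assoc, Total.toPushed_pushedMap]
        exact hk'.symm
    have hj : gj.unop = b ≫ k := by
      refine Total.toPushed_hom_ext ?_ ?_
      · exact (congrArg₂ (· ≫ ·) hk (Total.pushedMap_base _ _ _ _ n)).trans
          (pullback.lift_snd _ _ _) |>.symm
      · rw [← Category.assoc, Total.toPushed_pushedMap]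
        exact e'.symm.trans hk'.symm
    have hi' : X.map gi.op = X.map a.op.op ≫ X.map k.op.op :=
      (congrArg (fun l => X.map (Quiver.Hom.op (Quiver.Hom.op l))) hi).trans
        (X.map_comp a.op.op k.op.op)
    have hj' : X.map gj.op = X.map b.op.op ≫ X.map k.op.op :=
      (congrArg (fun l => X.map (Quiver.Hom.op (Quiver.Hom.op l))) hj).trans
        (X.map_comp b.op.op k.op.op)
    exact (ConcreteCategory.congr_hom hi' (x i)).trans
      ((congrArg (X.map k.op.op) (h (i, j))).trans (ConcreteCategory.congr_hom hj' (x j)).symm)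

theorem isContinuous_iff [HasFiniteLimits C] (J : GrothendieckTopology C) :
    Y.IsContinuous J ↔ ∀ ⦃c : C⦄ ⦃I : Type u⦄ (d : I → C) (s : ∀ i, d i ⟶ c),
      Sieve.ofArrows d s ∈ J c → ∀ n : G.Et (P.obj (op c)),
        Presieve.IsSheafFor (toPresheaf Y)
          (Presieve.ofArrows _ fun i => (Total.toPushed (s i) n).op) := by
  refine forall₂_congr fun c I => forall₂_congr fun d s => imp_congr_right fun _ => ?_
  have h := Sheaf.isLimit_fork_iff (fun i => fibMap Y (s i)) Prod.fst Prod.snd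
    (fun p : I × I => fibTransition Y (s p.1) (pullback.fst (s p.1) (s p.2)) _ rfl)
    (fun p : I × I => fibTransition Y (s p.2) (pullback.snd (s p.1) (s p.2)) _
      pullback.condition.symm) (fun p => by
        refine ObjectProperty.hom_ext _ (NatTrans.ext (funext fun n => ?_))
        -- Either composite is the action of the cocartesian map over `r`, which does not depend on
        -- the chosen factorization of `r`. Hence the descent diagram is always a fork.
        have h (i : I) {e : C} (t : e ⟶ d i) (r : e ⟶ c) (w : t ≫ s i = r) :
            (fibMap Y (s i) ≫ fibTransition Y (s i) t r w).hom.app n =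
              (toPresheaf Y).map (Total.toPushed r n.unop.unop).op.op := by
          refine (congrArg₂ (· ≫ ·) (toPresheaf_map_toPushed (Y := Y) (s i) n.unop.unop).symm
            (fibTransition_app Y (s i) t r w n.unop.unop)).trans ?_
          refine ((toPresheaf Y).map_comp _ _).symm.trans ?_
          exact congrArg (fun l => (toPresheaf Y).map (Quiver.Hom.op (Quiver.Hom.op l)))
            (Total.toPushed_pushedMap (s i) t r w n.unop.unop)
        exact (h _ _ _ _).trans (h _ _ _ _).symm)
  refine h.trans ((equivToOpposite.trans equivToOpposite).forall_congr_right.symm.trans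
    (forall_congr' fun n => ?_))
  refine Iff.trans ?_ (Presieve.isSheafFor_arrows_iff (toPresheaf Y) _).symm
  refine forall_congr' fun x => imp_congr ?_ (existsUnique_congr fun t => forall_congr' fun i => ?_)
  · refine Iff.trans ?_ (compatible_toPushed_iff (X := toPresheaf Y) s n x).symm
    refine forall_congr' fun p => ?_
    exact Eq.congr (ConcreteCategory.congr_hom (fibTransition_app Y _ _ _ _ n) _)
      (ConcreteCategory.congr_hom (fibTransition_app Y _ _ _ _ n) _)
  · exact Eq.congr_left (ConcreteCategory.congr_hom
      (toPresheaf_map_toPushed (Y := Y) (s i) n).symm t)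

end FibSection

end Geometry

/-! ### The sheaf criterion and the equivalence -/

namespace Geometry

variable {T : Type u} [SmallCategory T] [HasFiniteLimits T] {G : Geometry T}
variable {C : Type u} [SmallCategory C] {P : Cᵒᵖ ⥤ Models T} (J : GrothendieckTopology C)

/-- This sieve is the pullback of a horizontal cover along the map `(c, 𝟙) ⟶ (c, n)` of the total
category given by `n.hom`; that map lies over `𝟙 c`, so `S` is unchanged. -/
theorem overSieve_mem {c : C} {S : Sieve c} (hS : S ∈ J c) (n : G.Et (P.obj (op c))) :
    overSieve n S ∈ G.totalTopology P J (op _) := by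
  let f : op ((G.fiberInclusion P c).obj n) ⟶ (G.baseInclusion P).obj c :=
    Quiver.Hom.op ⟨𝟙 c, n.hom, congrArg (· ≫ n.hom) (P.map_id _).symm⟩
  have h : Sieve.generate (S.arrows.map (G.baseInclusion P)) ∈ G.totalTopology P J _ :=
    Precoverage.generate_mem_toGrothendieck (TotalCover.horizontal S.arrows (by simpa using hS))
  have h' := (G.totalTopology P J).pullback_stable f h
  have e := pullback_generate_baseInclusion S.arrows f
  rw [Sieve.generate_sieve] at e
  refine (congrArg (· ∈ G.totalTopology P J _) (e.trans ?_)).mp h'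
  exact congrArg (overSieve n) S.pullback_id

/-- A presheaf on the total category is a sheaf if and only if it is a sheaf on each fibre and for
the sieves over the covering sieves in the base. -/
theorem isSheaf_totalTopology {H : (G.Total P)ᵒᵖᵒᵖ ⥤ Type u}
    (h₁ : ∀ c, Presheaf.IsSheaf (G.spectralTopology (P.obj (op c)))
      ((G.fiberInclusion P c).op.op ⋙ H))
    (h₂ : ∀ (c : C) (S : Sieve c), S ∈ J c → ∀ n : G.Et (P.obj (op c)),
      Presieve.IsSheafFor H (overSieve n S).arrows) :
    Presheaf.IsSheaf (G.totalTopology P J) H := by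
  simp_rw [isSheaf_iff_isSheaf_of_type] at h₁ ⊢
  -- Stability of the generating families under pullback is not available here, so the sheaf
  -- condition is checked on every pullback of each generated sieve.
  refine (Precoverage.isSheaf_toGrothendieck_iff _).2 fun {_ W f} R hR => ?_
  obtain ⟨R, hR⟩ | ⟨c, R, hR⟩ := hR
  · have e := pullback_generate_baseInclusion R (Z := W.unop) f
    refine (congrArg (fun S : Sieve W => Presieve.IsSheafFor H S.arrows) e).mpr ?_
    exact h₂ W.unop.base _ (J.pullback_stable _ hR) W.unop.fiber
  · rw [Sieve.generate_map_eq_functorPushforward]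
    exact isSheafFor_pullback_functorPushforward h₁ hR f.unop

namespace FibSection

variable [HasFiniteLimits C]

theorem isSheaf_toPresheaf {Y : FibSection (G.spectralPseudofunctor P)} (hY : Y.IsContinuous J) :
    Presheaf.IsSheaf (G.totalTopology P J) (toPresheaf Y) := by
  refine isSheaf_totalTopology J (fun c => ?_) fun c S hS n => ?_
  · refine (Presheaf.isSheaf_of_iso_iff ?_).2 (fib Y c).property
    exact NatIso.ofComponents (fun n => Iso.refl _) fun {n m} f =>
      (Category.comp_id _).trans ((toPresheaf_map_fiberInclusion f.unop.unop).trans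
        (Category.id_comp _).symm)
  -- Continuity speaks of indexed families, so the covering sieve is written as the one generated by
  -- a family of arrows.
  · obtain ⟨I, d, s, rfl⟩ := S.exists_eq_ofArrows
    rw [overSieve_ofArrows, ← Presieve.isSheafFor_iff_generate]
    exact (isContinuous_iff Y J).1 hY d s hS n

theorem isContinuous_ofPresheaf {X : (G.Total P)ᵒᵖᵒᵖ ⥤ Type u}
    (hX : Presheaf.IsSheaf (G.totalTopology P J) X) :
    (ofPresheaf X (isSheaf_fiberInclusion hX)).IsContinuous J := by
  refine (isContinuous_iff _ J).2 fun c I d s hs n => ?_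
  refine Presieve.isSheafFor_iso (toPresheafOfPresheafIso X _).symm ?_
  rw [Presieve.isSheafFor_iff_generate, ← overSieve_ofArrows]
  exact (isSheaf_iff_isSheaf_of_type _ _).1 hX _ (overSieve_mem J hs n)

variable (P)

/-- The functor that takes a continuous section to the associated sheaf on the total site. -/
noncomputable def toTotalSpec :
    ContinuousSections J (G.spectralPseudofunctor P) ⥤ G.TotalSpec P J where
  obj Y := ⟨toPresheaf Y.obj, isSheaf_toPresheaf J Y.property⟩
  map φ := ⟨toPresheafMap φ.hom⟩
  map_id _ := rfl
  map_comp _ _ := rfl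

instance : (toTotalSpec (G := G) P J).Full where
  map_surjective ψ := ⟨⟨ofPresheafMap ψ.hom⟩, rfl⟩

instance : (toTotalSpec (G := G) P J).Faithful where
  map_injective {Y Y' φ φ'} h := by
    refine ObjectProperty.hom_ext _ (FibSection.Hom.ext (funext fun a => ?_))
    refine ObjectProperty.hom_ext _ (NatTrans.ext (funext fun n => ?_))
    exact congrArg (fun k => k.hom.app (op (op ⟨a.unop, n.unop.unop⟩))) h

instance : (toTotalSpec (G := G) P J).EssSurj where
  -- The preimage is the section formed by the restrictions of `X` to the fibres; the isomorphism of
  -- presheaves lifts because sheaves form a full subcategory.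
  mem_essImage X := ⟨⟨_, isContinuous_ofPresheaf J X.property⟩,
    ⟨(sheafToPresheaf _ _).preimageIso (toPresheafOfPresheafIso X.obj _)⟩⟩

instance : (toTotalSpec (G := G) P J).IsEquivalence where

end FibSection

end Geometry

theorem mainTheorem3 {T : Type u} [SmallCategory T] [HasFiniteLimits T] (G : Geometry T)
    {C : Type u} [SmallCategory C] [HasFiniteLimits C] (J : GrothendieckTopology C)
    {A : Type w} [Category.{v} A] (e : A ≌ Sheaf J (Type u)) (F : T ⥤ₗ A) :
    (∀ ⦃c c' : C⦄ (s : c ⟶ c'),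
      CoverPreserving (G.spectralTopology ((evalModel e F).obj (op c')))
        (G.spectralTopology ((evalModel e F).obj (op c)))
        (G.push ((evalModel e F).map s.op)).op) ∧
    Nonempty (G.TotalSpec (evalModel e F) J ≌
      ContinuousSections J (G.spectralPseudofunctor (evalModel e F))) :=
  ⟨fun _ _ _ => CoverPreserving.of_isContinuous _ _ _,
    ⟨(Geometry.FibSection.toTotalSpec _ J).asEquivalence.symm⟩⟩
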